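/- Let $\mathcal E=\mathbb Z[\omega]$, $\omega=e^{2\pi i/3}$, be the ring of Eisenstein integers and $\theta=\omega-\omega^2=\sqrt{-3}$. For $n\ge 1$ let $\mathcal E_n$ be the free module $\mathcal E^n$ with the hermitian form $\langle\cdot,\cdot\rangle$ (antilinear in the first variable) whose Gram matrix has $3$ on the diagonal, $\theta$ just above the diagonal, $\bar\theta$ just below it, and $0$ elsewhere. Direct sums carry the orthogonal sum of the forms, and $kL$ denotes the orthogonal sum of $k$ copies of $L$. Let $z=-\theta\,(1,0,1)\in\mathcal E_3$; it has norm $\langle z,z\rangle=18$, and $z/3$ generates the discriminant group of the underlying $\mathbb Z$-lattice $E_6(-1)$ of $\mathcal E_3$, which is cyclic of order $3$. Let $\widetilde{3\mathcal E_3}\subset 3\mathcal E_3\otimes_{\mathcal E}\mathbb Q(\omega)$ be the index $3$ overlattice of $3\mathcal E_3$ generated by $3\mathcal E_3$ and $\tfrac13(z,z,z)$. For such a lattice $\mathcal G$ let $\mathrm O(\mathcal G)$ be the group of $\mathcal E$-linear automorphisms of $\mathcal G$ preserving the form, and let $W(\mathcal G)\subset \mathrm O(\mathcal G)$ be the (normal)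 subgroup generated by the triflections $$R_r\colon x\mapsto x-(1-\omega)\frac{\langle r,x\rangle}{\langle r,r\rangle}\,r,\qquad r\in\mathcal G,\ \langle r,r\rangle=3 .$$ Let $S_n$ denote the symmetric group on $n$ elements. Then: 1. $\mathrm O(\mathcal E_1+2\mathcal E_4)\cong \bigl(W(\mathcal E_1)\times\mathbb Z/2\mathbb Z\bigr)\times\bigl(W(\mathcal E_4)^{\times 2}\rtimes S_2\bigr)$, where $S_2$ permutes the two factors $W(\mathcal E_4)$. 2. $\mathrm O(\widetilde{3\mathcal E_3})\cong\bigl(W(\mathcal E_3)^{\times 3}\rtimes S_3\bigr)\rtimes\mathbb Z/2\mathbb Z$, where $S_3$ permutes the three factors $W(\mathcal E_3)$, and where $\mathbb Z/2\mathbb Z=\langle\tau\rangle$ for an involution $\tau\in \mathrm O(\mathcal E_3)\setminus W(\mathcal E_3)$, acting on $W(\mathcal E_3)^{\times 3}$ by conjugation by $(\tau,\tau,\tau)$ and trivially on $S_3$. Such involutions $\tau$ exist, and the isomorphism holds for each of them. -/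

import Mathlib

open scoped Matrix

namespace Eisenstein

/-- The ring `ℤ[ω]` of Eisenstein integers `x + y ω`, where `ω² = -1 - ω`.  The `star` of this ring
is complex conjugation, `x + y ω ↦ (x - y) - y ω`. -/
abbrev EInt : Type := QuadraticAlgebra ℤ (-1) (-1)

/-- The field `ℚ(ω)`, with the same conventions. -/
abbrev EField : Type := QuadraticAlgebra ℚ (-1) (-1)

/-- The inclusion `ℤ[ω] → ℚ(ω)`. -/
def toField : EInt →+* EField where
  toFun z := ⟨z.re, z.im⟩
  map_one' := by ext <;> simp [QuadraticAlgebra.re_one, QuadraticAlgebra.im_one]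
  map_mul' x y := by ext <;> simp
  map_zero' := by ext <;> simp
  map_add' x y := by ext <;> simp

instance : Algebra EInt EField := toField.toAlgebra

/-- The cube root of unity `ω`. -/
def omega : EInt := ⟨0, 1⟩

/-- `θ = ω - ω² = √-3`. -/
def theta : EInt := omega - omega ^ 2

/-- The sesquilinear form `⟨x, y⟩ = ∑ i j, conj (x i) * B i j * y j` with Gram matrix `B`,
antilinear in the first variable and linear in the second. -/
def gramForm {n R : Type*} [Fintype n] [CommRing R] [StarRing R] (B : Matrix n n R)
    (x y : n → R) : R :=
  star x ⬝ᵥ (B *ᵥ y)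

/-- The Gram matrix of `𝓔ₙ`: `3` on the diagonal, `θ` just above it, `conj θ` just below it. -/
def gram (n : ℕ) : Matrix (Fin n) (Fin n) EInt :=
  Matrix.of fun i j =>
    if i = j then 3
    else if (i : ℕ) + 1 = j then theta
    else if (j : ℕ) + 1 = i then star theta
    else 0

/-- The hermitian form of the lattice `𝓔ₙ`, whose underlying module is `ℤ[ω]ⁿ`. -/
def form (n : ℕ) : (Fin n → EInt) → (Fin n → EInt) → EInt :=
  gramForm (gram n)

/-- The orthogonal sum of two forms. -/
def orthSum {M N R : Type*} [Add R] (h : M → M → R) (k : N → N → R) (x y : M × N) : R :=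
  h x.1 y.1 + k x.2 y.2

/-- The orthogonal sum of copies, indexed by `ι`, of a form. -/
def orthCopies (ι : Type*) [Fintype ι] {M R : Type*} [AddCommMonoid R] (h : M → M → R)
    (x y : ι → M) : R :=
  ∑ i, h (x i) (y i)

/-- The isometry group: the `ℤ[ω]`-linear automorphisms that preserve the form. -/
def isometryGroup {M R : Type*} [AddCommGroup M] [Module EInt M] (h : M → M → R) :
    Subgroup (M ≃ₗ[EInt] M) where
  carrier := {φ | ∀ x y, h (φ x) (φ y) = h x y}
  one_mem' := fun _ _ => rfl
  mul_mem' := fun {φ ψ} hφ hψ x y => (hφ (ψ x) (ψ y)).trans (hψ x y)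
  inv_mem' := fun {φ} hφ x y => by
    have h1 : ∀ z, φ (φ⁻¹ z) = z := fun z => φ.apply_symm_apply z
    have h2 := hφ (φ⁻¹ x) (φ⁻¹ y)
    rw [h1, h1] at h2
    exact h2.symm

/-- `φ` is the triflection `x ↦ x - (1 - ω) (⟨r, x⟩ / ⟨r, r⟩) r` in the Eisenstein root `r`
(a vector of norm `⟨r, r⟩ = 3`), with the denominator `3` cleared. -/
def IsTriflection {M : Type*} [AddCommGroup M] [Module EInt M] (h : M → M → EInt) (r : M)
    (φ : M ≃ₗ[EInt] M) : Prop :=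
  h r r = 3 ∧ ∀ x, (3 : EInt) • φ x = (3 : EInt) • x - ((1 - omega) * h r x) • r

/-- The complex reflection group `W`: the group of isometries generated by the triflections in
all Eisenstein roots. -/
def weylGroup {M : Type*} [AddCommGroup M] [Module EInt M] (h : M → M → EInt) :
    Subgroup (isometryGroup h) :=
  Subgroup.closure {φ | ∃ r : M, IsTriflection h r (φ : M ≃ₗ[EInt] M)}

/-- `W` is normal in the isometry group: conjugates of triflections are triflections. -/
instance weylGroup_normal {M : Type*} [AddCommGroup M] [Module EInt M] (h : M → M → EInt) :
    (weylGroup h).Normal := by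
  apply Subgroup.Normal.mk
  have key : ∀ g φ : isometryGroup h, (∃ r : M, IsTriflection h r (φ : M ≃ₗ[EInt] M)) →
      ∃ r : M, IsTriflection h r ((g * φ * g⁻¹ : isometryGroup h) : M ≃ₗ[EInt] M) := by
    rintro g φ ⟨r, hr, hx⟩
    have h1 : ∀ z, (g : M ≃ₗ[EInt] M) ((g : M ≃ₗ[EInt] M)⁻¹ z) = z :=
      fun z => (g : M ≃ₗ[EInt] M).apply_symm_apply z
    refine ⟨(g : M ≃ₗ[EInt] M) r, (g.2 r r).trans hr, fun x => ?_⟩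
    have h2 := hx ((g : M ≃ₗ[EInt] M)⁻¹ x)
    have h3 := g.2 r ((g : M ≃ₗ[EInt] M)⁻¹ x)
    rw [h1] at h3
    have h4 := congrArg (g : M ≃ₗ[EInt] M) h2
    rw [map_sub, map_smul, map_smul, map_smul, h1, ← h3] at h4
    exact h4
  intro n hn g
  induction hn using Subgroup.closure_induction with
  | mem φ hφ => exact Subgroup.subset_closure (key g φ hφ)
  | one => simp
  | mul a b _ _ ha hb =>
    have : g * (a * b) * g⁻¹ = (g * a * g⁻¹) * (g * b * g⁻¹) := by group
    rw [this]
    exact Subgroup.mul_mem _ ha hb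
  | inv a _ ha =>
    have : g * a⁻¹ * g⁻¹ = (g * a * g⁻¹)⁻¹ := by group
    rw [this]
    exact Subgroup.inv_mem _ ha

/-- The hermitian form of the lattice `𝓔₁ + 2𝓔₄`. -/
def formE1E4E4 : (Fin 1 → EInt) × (Fin 2 → Fin 4 → EInt) →
    (Fin 1 → EInt) × (Fin 2 → Fin 4 → EInt) → EInt :=
  orthSum (form 1) (orthCopies (Fin 2) (form 4))

/-- The vector `z = -θ (1, 0, 1)` of `𝓔₃`.  It has hermitian norm `18` (norm `-12` for the
underlying even lattice `E₆(-1)`, where it has divisibility `3`), and `z / 3` generates the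
discriminant group of `E₆(-1)`, cyclic of order `3`. -/
def glueVector : Fin 3 → EInt := ![-theta, 0, -theta]

/-- The index 3 overlattice of `3𝓔₃` in `3𝓔₃ ⊗ ℚ(ω)`: it is generated by the integral vectors and
`(z, z, z) / 3`. -/
def overlattice : Submodule EInt (Fin 3 → Fin 3 → EField) :=
  Submodule.span EInt
    (Set.range (fun (x : Fin 3 → Fin 3 → EInt) i j => toField (x i j)) ∪
      {fun _ j => (1 / 3 : ℚ) • toField (glueVector j)})

/-- The form of `3𝓔₃ ⊗ ℚ(ω)`, restricted to the overlattice. -/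
def overlatticeForm (x y : overlattice) : EField :=
  orthCopies (Fin 3) (gramForm ((gram 3).map toField)) x.1 y.1

/-- The semidirect product `Wᵏ ⋊ S_k`, in which `S_k` permutes the factors of `Wᵏ`. -/
abbrev Wreath (W : Type*) [Group W] (k : ℕ) : Type _ :=
  (Fin k → W) ⋊[mulAutArrow] Equiv.Perm (Fin k)

/-- For a normal subgroup `W` of `G`, the action of `G` on `Wᵏ ⋊ S_k` by conjugation, diagonally on
`Wᵏ` and trivially on `S_k`. -/
def diagConj {G : Type*} [Group G] (W : Subgroup G) [W.Normal] (k : ℕ) :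
    G →* MulAut (Wreath W k) where
  toFun g :=
    { toFun := fun x => ⟨fun i => MulAut.conjNormal g (x.left i), x.right⟩
      invFun := fun x => ⟨fun i => MulAut.conjNormal g⁻¹ (x.left i), x.right⟩
      left_inv := fun x => by ext <;> simp
      right_inv := fun x => by ext <;> simp
      map_mul' := fun x y => by
        refine SemidirectProduct.ext (funext fun i => ?_) rfl
        exact map_mul (MulAut.conjNormal g) (x.left i) (y.left (x.right⁻¹ i)) }
  map_one' := by ext <;> simp
  map_mul' g g' := by ext <;> simp [mul_assoc]

end Eisenstein

namespace Eisenstein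

/-! ### Arithmetic of the Eisenstein integers -/

open scoped QuadraticAlgebra

/-! All inner products lie in the ideal `(θ)`, so every norm is a multiple of 3 and roots (norm 3)
are minimal vectors. Hence a root of an orthogonal sum lies in one summand. Since `𝓔ₙ` is spanned by
a chain of roots whose neighbours are not orthogonal, an isometry carries each copy of `𝓔ₙ` into a
single summand. This gives `O(k𝓔ₙ) = O(𝓔ₙ) ≀ S_k`. It also splits `O(𝓔₁ + 2𝓔₄)` as a product,
because inner products in `𝓔₁` are divisible by 3 and so `𝓔₄` cannot map into it.

It remains to compare `O(𝓔ₙ)` with `W(𝓔ₙ)`. For `n = 1` the isometries are the six units and `W`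
consists of the cube roots of unity. For `n = 3, 4` an isometry is corrected by elements of `W` so
that it fixes the roots of the chain one after another. The engine is `conj_of_sub`: if `r`, `s` and
`r - s` are roots and `r` is not proportional to `r - s`, a triflection in `r - s` or its inverse
takes `r` to `s` and fixes everything orthogonal to `r - s`. If the trace of `⟨r, s⟩` is positive,
then `r = s` or `r - s` is a root. To reach positivity, one uses a few candidate roots whose sum
lies in the span of the roots already fixed: the traces of their products with `r` then have a known
positive sum.

For `𝓔₄` this reaches the end of the chain, so `O = W`. For `𝓔₃` two images of the last root
survive. They are told apart by the action on `d = (1, 0, 1)` modulo `θ`: `W` acts trivially there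
since `⟨x, d⟩` is always divisible by 3, and the other isometries act as `-1`. So `W(𝓔₃)` is the
index two kernel of a sign.

For the overlattice, multiply by `θ`, so that it becomes `{c(d, d, d) + θy}`. Its vectors of norm 9
all lie in `θ·3𝓔₃`, which the vectors `θ·root` span; hence every isometry extends to `3𝓔₃` and lies
in `O(𝓔₃) ≀ S₃`. It preserves the overlattice exactly when its three components have the same sign,
and any involution `τ` of sign `-1` splits this sign. -/

theorem theta_eq : theta = ⟨1, 2⟩ := by
  ext <;> simp [theta, omega, pow_two]

/-- The trace of `ℤ[ω]` over `ℤ`. -/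
def tr (z : EInt) : ℤ := 2 * z.re - z.im

/-- The norm of `ℤ[ω]` over `ℤ`. -/
def nm (z : EInt) : ℤ := z.re ^ 2 - z.re * z.im + z.im ^ 2

theorem star_mul_self (z : EInt) : star z * z = ⟨nm z, 0⟩ := by
  ext <;> simp [nm] <;> ring

theorem nm_mul (z w : EInt) : nm (z * w) = nm z * nm w := by simp [nm]; ring

theorem nm_star (z : EInt) : nm (star z) = nm z := by simp [nm]; ring

theorem nm_nonneg (z : EInt) : 0 ≤ nm z := by
  unfold nm; nlinarith [sq_nonneg (2 * z.re - z.im), sq_nonneg z.im]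

theorem nm_eq_zero {z : EInt} : nm z = 0 ↔ z = 0 := by
  constructor
  · intro h
    unfold nm at h
    have him : z.im = 0 := by
      have : z.im ^ 2 = 0 := by nlinarith [sq_nonneg (2 * z.re - z.im), sq_nonneg z.im]
      simpa using this
    have hre : z.re = 0 := by simpa [him] using h
    ext <;> simp [him, hre]
  · rintro rfl; simp [nm]

theorem eint_mul_eq_zero {z w : EInt} (h : z * w = 0) : z = 0 ∨ w = 0 := by
  have := congrArg nm h
  rw [nm_mul, nm_eq_zero.2 rfl, mul_eq_zero, nm_eq_zero, nm_eq_zero] at this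
  exact this

instance : NoZeroDivisors EInt := ⟨eint_mul_eq_zero⟩

theorem theta_ne_zero : theta ≠ 0 := by
  rw [theta_eq]; intro h; simpa using congrArg QuadraticAlgebra.re h

theorem star_theta : star theta = -theta := by
  rw [theta_eq]; ext <;> simp

theorem theta_sq : theta * theta = -3 := by
  rw [theta_eq]; ext <;> simp

/-- Division by `θ`, exact on the multiples of `θ`. -/
def divTheta (z : EInt) : EInt := ⟨(2 * z.im - z.re) / 3, (z.im - 2 * z.re) / 3⟩

theorem divTheta_theta_mul (a : EInt) : divTheta (theta * a) = a := by
  rw [theta_eq]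
  ext <;> simp [divTheta] <;> omega

theorem theta_mul_divTheta {z : EInt} (h : theta ∣ z) : theta * divTheta z = z := by
  obtain ⟨a, rfl⟩ := h
  rw [divTheta_theta_mul]

theorem tr_theta_mul (a : EInt) : tr (theta * a) = -3 * a.im := by
  rw [theta_eq]; simp [tr]; ring

theorem nm_theta : nm theta = 3 := by rw [theta_eq]; rfl

theorem three_dvd_tr {z : EInt} (h : theta ∣ z) : 3 ∣ tr z := by
  obtain ⟨a, rfl⟩ := h
  rw [tr_theta_mul]
  exact ⟨-a.im, by ring⟩

/-- Modulo `θ` one has `ω ≡ 1`, so the residue of `a` in the field with three elements is `a.re +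
a.im`. -/
theorem theta_dvd_of_three_dvd {a : EInt} (h : 3 ∣ a.re + a.im) : theta ∣ a := by
  refine ⟨⟨(2 * a.im - a.re) / 3, (a.im - 2 * a.re) / 3⟩, ?_⟩
  rw [theta_eq]; ext <;> simp <;> omega

/-! ### Eisenstein forms, roots and triflections -/

/-- A positive definite hermitian form over `ℤ[ω]` with values in the ideal generated by `θ`. -/
structure IsEisensteinForm {M : Type*} [AddCommGroup M] [Module EInt M] (h : M → M → EInt) :
    Prop where
  add_right : ∀ x y z, h x (y + z) = h x y + h x z
  smul_right : ∀ (c : EInt) x y, h x (c • y) = c * h x y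
  star_eq : ∀ x y, star (h x y) = h y x
  theta_dvd : ∀ x y, theta ∣ h x y
  pos : ∀ x, x ≠ 0 → 0 < (h x x).re

namespace IsEisensteinForm

variable {M : Type*} [AddCommGroup M] [Module EInt M] {h : M → M → EInt}

theorem add_left (hh : IsEisensteinForm h) (x y z : M) : h (x + y) z = h x z + h y z := by
  rw [← hh.star_eq z, hh.add_right, star_add, hh.star_eq, hh.star_eq]

theorem smul_left (hh : IsEisensteinForm h) (c : EInt) (x y : M) :
    h (c • x) y = star c * h x y := by
  rw [← hh.star_eq y, hh.smul_right, star_mul, hh.star_eq, mul_comm]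

theorem zero_right (hh : IsEisensteinForm h) (x : M) : h x 0 = 0 := by
  simpa using hh.smul_right 0 x 0

theorem zero_left (hh : IsEisensteinForm h) (x : M) : h 0 x = 0 := by
  simpa using hh.smul_left 0 0 x

theorem neg_right (hh : IsEisensteinForm h) (x y : M) : h x (-y) = -h x y := by
  simpa using hh.smul_right (-1) x y

theorem neg_left (hh : IsEisensteinForm h) (x y : M) : h (-x) y = -h x y := by
  simpa using hh.smul_left (-1) x y

theorem sub_right (hh : IsEisensteinForm h) (x y z : M) : h x (y - z) = h x y - h x z := by
  rw [sub_eq_add_neg, hh.add_right, hh.neg_right, sub_eq_add_neg]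

theorem sub_left (hh : IsEisensteinForm h) (x y z : M) : h (x - y) z = h x z - h y z := by
  rw [sub_eq_add_neg, hh.add_left, hh.neg_left, sub_eq_add_neg]

theorem sum_right (hh : IsEisensteinForm h) {ι : Type*} (s : Finset ι) (x : M) (f : ι → M) :
    h x (∑ i ∈ s, f i) = ∑ i ∈ s, h x (f i) :=
  map_sum (AddMonoidHom.mk' (h x) (hh.add_right x)) f s

theorem self_im (hh : IsEisensteinForm h) (x : M) : (h x x).im = 0 := by
  have := congrArg QuadraticAlgebra.im (hh.star_eq x x)
  simp at this
  omega

theorem tr_self (hh : IsEisensteinForm h) (x : M) : tr (h x x) = 2 * (h x x).re := by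
  simp [tr, hh.self_im]

theorem self_eq_three_iff (hh : IsEisensteinForm h) (x : M) : h x x = 3 ↔ (h x x).re = 3 := by
  constructor
  · intro H; rw [H]; rfl
  · intro H; ext
    · rw [H]; rfl
    · rw [hh.self_im]; rfl

/-- The trace of a multiple of `θ` is divisible by 3, and here it is twice the norm. This makes
roots the minimal vectors. -/
theorem three_dvd (hh : IsEisensteinForm h) (x : M) : 3 ∣ (h x x).re := by
  have := three_dvd_tr (hh.theta_dvd x x)
  rw [hh.tr_self] at this
  omega

theorem nonneg (hh : IsEisensteinForm h) (x : M) : 0 ≤ (h x x).re := by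
  by_cases hx : x = 0
  · simp [hx, hh.zero_right]
  · exact (hh.pos x hx).le

theorem eq_zero_of_re (hh : IsEisensteinForm h) {x : M} (H : (h x x).re ≤ 0) : x = 0 := by
  by_contra hx
  exact absurd (hh.pos x hx) (not_lt.2 H)

theorem three_le (hh : IsEisensteinForm h) {x : M} (hx : x ≠ 0) : 3 ≤ (h x x).re := by
  have := hh.pos x hx
  have := hh.three_dvd x
  omega

theorem ne_zero_of_root (hh : IsEisensteinForm h) {r : M} (hr : h r r = 3) : r ≠ 0 := by
  rintro rfl
  rw [hh.zero_right] at hr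
  simpa using congrArg QuadraticAlgebra.re hr

theorem smul_self (hh : IsEisensteinForm h) (c : EInt) (x : M) :
    (h (c • x) (c • x)).re = nm c * (h x x).re := by
  rw [hh.smul_left, hh.smul_right, ← mul_assoc, star_mul_self]
  simp

theorem smul_eq_zero (hh : IsEisensteinForm h) {c : EInt} {x : M} (hc : c ≠ 0)
    (H : c • x = 0) : x = 0 := by
  have := hh.smul_self c x
  rw [H, hh.zero_right] at this
  simp only [QuadraticAlgebra.re_zero] at this
  rcases mul_eq_zero.1 this.symm with h0 | h0
  · exact absurd (nm_eq_zero.1 h0) hc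
  · exact hh.eq_zero_of_re h0.le

theorem smul_cancel (hh : IsEisensteinForm h) {c : EInt} {x y : M} (hc : c ≠ 0)
    (H : c • x = c • y) : x = y := by
  rw [← sub_eq_zero] at H ⊢
  rw [← smul_sub] at H
  exact hh.smul_eq_zero hc H

theorem norm_sub (hh : IsEisensteinForm h) (x y : M) :
    (h (x - y) (x - y)).re = (h x x).re + (h y y).re - tr (h x y) := by
  have := congrArg QuadraticAlgebra.re (hh.star_eq x y)
  simp only [hh.sub_left, hh.sub_right, QuadraticAlgebra.re_sub, ← this, tr,
    QuadraticAlgebra.re_star]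
  ring

theorem norm_add (hh : IsEisensteinForm h) (x y : M) :
    (h (x + y) (x + y)).re = (h x x).re + (h y y).re + tr (h x y) := by
  have := congrArg QuadraticAlgebra.re (hh.star_eq x y)
  simp only [hh.add_left, hh.add_right, QuadraticAlgebra.re_add, ← this, tr,
    QuadraticAlgebra.re_star]
  ring

/-- The inner products of two Eisenstein roots satisfy the Cauchy-Schwarz inequality. -/
theorem nm_le (hh : IsEisensteinForm h) {r s : M} (hr : h r r = 3) (hs : h s s = 3) :
    nm (h r s) ≤ 9 ∧ (nm (h r s) = 9 → (3 : EInt) • s = h r s • r) := by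
  -- Three times the component of `s` orthogonal to `r`; its norm is nonnegative, and zero only when
  -- it vanishes.
  have key : (h ((3 : EInt) • s - h r s • r) ((3 : EInt) • s - h r s • r)).re
      = 27 - 3 * nm (h r s) := by
    rw [hh.norm_sub, hh.smul_self, hh.smul_self, hr, hs, hh.smul_left, hh.smul_right,
      ← hh.star_eq r s]
    simp [tr, nm]
    ring
  constructor
  · have := hh.nonneg ((3 : EInt) • s - h r s • r)
    omega
  · intro H
    exact sub_eq_zero.1 (hh.eq_zero_of_re (by omega))

/-- The linear functional `x ↦ ⟨r, x⟩ / θ`. -/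
def coord (hh : IsEisensteinForm h) (r : M) : M →ₗ[EInt] EInt where
  toFun x := divTheta (h r x)
  map_add' x y := by
    apply mul_left_cancel₀ theta_ne_zero
    rw [mul_add, theta_mul_divTheta (hh.theta_dvd _ _), theta_mul_divTheta (hh.theta_dvd _ _),
      theta_mul_divTheta (hh.theta_dvd _ _), hh.add_right]
  map_smul' c x := by
    apply mul_left_cancel₀ theta_ne_zero
    rw [smul_eq_mul, RingHom.id_apply, mul_left_comm, theta_mul_divTheta (hh.theta_dvd _ _),
      theta_mul_divTheta (hh.theta_dvd _ _), hh.smul_right]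

theorem theta_mul_coord (hh : IsEisensteinForm h) (r x : M) : theta * hh.coord r x = h r x :=
  theta_mul_divTheta (hh.theta_dvd _ _)

theorem coord_self (hh : IsEisensteinForm h) {r : M} (hr : h r r = 3) :
    hh.coord r r = -theta := by
  apply mul_left_cancel₀ theta_ne_zero
  rw [hh.theta_mul_coord, hr, mul_neg, theta_sq, neg_neg]

/-- The triflection in an Eisenstein root, as a linear automorphism. -/
def triflectionEquiv (hh : IsEisensteinForm h) (r : M) (hr : h r r = 3) : M ≃ₗ[EInt] M where
  toFun x := x + (omega ^ 2 * hh.coord r x) • r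
  invFun x := x - (omega * hh.coord r x) • r
  map_add' x y := by rw [map_add, mul_add, add_smul]; abel
  map_smul' c x := by
    rw [map_smul, smul_eq_mul, mul_left_comm, mul_smul, smul_add, RingHom.id_apply]
  left_inv x := by
    have : omega ^ 2 * hh.coord r x - omega * (hh.coord r x +
        omega ^ 2 * hh.coord r x * -theta) = 0 := by
      rw [theta_eq]; ext <;> simp [omega, pow_two] <;> ring
    beta_reduce
    rw [map_add, map_smul, smul_eq_mul, hh.coord_self hr, add_sub_assoc, ← sub_smul, this,
      zero_smul, add_zero]
  right_inv x := by
    have : -(omega * hh.coord r x) + omega ^ 2 * (hh.coord r x -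
        omega * hh.coord r x * -theta) = 0 := by
      rw [theta_eq]; ext <;> simp [omega, pow_two] <;> ring
    beta_reduce
    rw [map_sub, map_smul, smul_eq_mul, hh.coord_self hr, sub_eq_add_neg, ← neg_smul, add_assoc,
      ← add_smul, this, zero_smul, add_zero]

/-- The triflection in an Eisenstein root, as an isometry. -/
def triflection (hh : IsEisensteinForm h) (r : M) (hr : h r r = 3) : isometryGroup h :=
  ⟨hh.triflectionEquiv r hr, fun x y => by
    change h (x + _) (y + _) = _
    rw [hh.add_left, hh.add_right, hh.add_right, hh.smul_left, hh.smul_left, hh.smul_right,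
      hh.smul_right, hr, ← hh.star_eq r x, ← hh.theta_mul_coord r x, ← hh.theta_mul_coord r y]
    generalize hh.coord r x = a
    generalize hh.coord r y = b
    rw [theta_eq, add_assoc, add_eq_left]
    ext <;> simp [omega, pow_two] <;> ring⟩

theorem triflection_apply (hh : IsEisensteinForm h) {r : M} (hr : h r r = 3) (x : M) :
    (hh.triflection r hr).1 x = x + (omega ^ 2 * hh.coord r x) • r := rfl

theorem triflection_inv_apply (hh : IsEisensteinForm h) {r : M} (hr : h r r = 3) (x : M) :
    (hh.triflection r hr)⁻¹.1 x = x - (omega * hh.coord r x) • r := rfl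

theorem isTriflection_triflection (hh : IsEisensteinForm h) {r : M} (hr : h r r = 3) :
    IsTriflection h r (hh.triflection r hr).1 := by
  refine ⟨hr, fun x => ?_⟩
  rw [hh.triflection_apply, ← hh.theta_mul_coord r x, smul_add, sub_eq_add_neg, ← neg_smul,
    ← mul_smul]
  congr 2
  rw [theta_eq]; ext <;> simp [omega, pow_two] <;> ring

theorem triflection_mem (hh : IsEisensteinForm h) {r : M} (hr : h r r = 3) :
    hh.triflection r hr ∈ weylGroup h :=
  Subgroup.subset_closure ⟨r, hh.isTriflection_triflection hr⟩

theorem eq_triflection (hh : IsEisensteinForm h) {r : M} {φ : isometryGroup h}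
    (H : IsTriflection h r φ.1) : φ = hh.triflection r H.1 := by
  apply Subtype.ext
  ext x
  apply hh.smul_cancel (c := 3) (by intro h0; simpa using congrArg QuadraticAlgebra.re h0)
  rw [H.2 x, (hh.isTriflection_triflection H.1).2 x]

theorem triflection_self (hh : IsEisensteinForm h) {r : M} (hr : h r r = 3) :
    (hh.triflection r hr).1 r = omega • r := by
  rw [hh.triflection_apply, hh.coord_self hr]
  nth_rw 1 [← one_smul EInt r]
  rw [← add_smul]
  congr 1

/-! ### Conjugacy of roots under the reflection group -/

/-- Two vectors are related by an element of the reflection group that fixes `C` pointwise. -/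
def Conj (h : M → M → EInt) (C : Set M) (r s : M) : Prop :=
  ∃ w ∈ weylGroup h, (∀ c ∈ C, w.1 c = c) ∧ w.1 r = s

theorem Conj.refl (C : Set M) (r : M) : Conj h C r r := ⟨1, one_mem _, fun _ _ => rfl, rfl⟩

theorem Conj.trans {C : Set M} {r s t : M} : Conj h C r s → Conj h C s t → Conj h C r t := by
  rintro ⟨w, hw, hc, rfl⟩ ⟨w', hw', hc', rfl⟩
  refine ⟨w' * w, mul_mem hw' hw, fun c h => ?_, rfl⟩
  change w'.1 (w.1 c) = c
  rw [hc c h, hc' c h]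

theorem Conj.symm {C : Set M} {r s : M} : Conj h C r s → Conj h C s r := by
  rintro ⟨w, hw, hc, rfl⟩
  refine ⟨w⁻¹, inv_mem hw, fun c h => ?_, w.1.symm_apply_apply r⟩
  exact (LinearEquiv.symm_apply_eq _).2 (hc c h).symm

theorem Conj.smul {C : Set M} {r s : M} (u : EInt) :
    Conj h C r s → Conj h C (u • r) (u • s) := by
  rintro ⟨w, hw, hc, rfl⟩
  exact ⟨w, hw, hc, map_smul _ _ _⟩

/-- If `r`, `s` and `r - s` are roots and `r` is not a multiple of `r - s`, then the triflection
in `r - s` or its inverse maps `r` to `s`. -/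
theorem conj_of_sub (hh : IsEisensteinForm h) {C : Set M} {r s : M} (hr : h r r = 3)
    (hs : h s s = 3) (hd : h (r - s) (r - s) = 3)
    (hne : (3 : EInt) • r ≠ h (r - s) r • (r - s))
    (hC : ∀ c ∈ C, h c r = h c s) : Conj h C r s := by
  have hfix : ∀ c ∈ C, hh.coord (r - s) c = 0 := fun c hc => by
    apply mul_left_cancel₀ theta_ne_zero
    rw [hh.theta_mul_coord, mul_zero, ← hh.star_eq, hh.sub_right, hC c hc, sub_self, star_zero]
  -- Strict Cauchy-Schwarz, as `r` and `r - s` are not proportional.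
  have hnm : nm (hh.coord (r - s) r) < 3 := by
    have h1 := hh.nm_le hd hr
    have h2 : nm (h (r - s) r) ≠ 9 := fun h => hne (h1.2 h)
    rw [← hh.theta_mul_coord, nm_mul, nm_theta] at h1 h2
    omega
  -- Expanding the norm of `-s = (r - s) - r` gives trace 3 for `⟨r - s, r⟩`.
  have htr : (hh.coord (r - s) r).im = -1 := by
    have h1 := tr_theta_mul (hh.coord (r - s) r)
    rw [hh.theta_mul_coord] at h1
    have h2 := hh.norm_sub (r - s) r
    have h3 : r - s - r = -s := by abel
    rw [h3, hh.neg_left, hh.neg_right, neg_neg, hs, hd, hr, h1] at h2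
    simp at h2
    omega
  -- So the coordinate is `-ω` or `ω²`: the triflection handles the first case and its inverse the
  -- second.
  have hre : (hh.coord (r - s) r).re = 0 ∨ (hh.coord (r - s) r).re = -1 := by
    simp only [nm, htr] at hnm
    have h1 : -2 < (hh.coord (r - s) r).re := by nlinarith
    have h2 : (hh.coord (r - s) r).re < 1 := by nlinarith
    omega
  rcases hre with hre | hre
  · have ha : omega ^ 2 * hh.coord (r - s) r = -1 := by
      ext <;> simp [omega, pow_two, hre, htr]
    refine ⟨hh.triflection _ hd, hh.triflection_mem hd, fun c hc => ?_, ?_⟩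
    · rw [hh.triflection_apply, hfix c hc]; simp
    · rw [hh.triflection_apply, ha]; simp
  · have ha : omega * hh.coord (r - s) r = 1 := by
      ext <;> simp [omega, hre, htr]
    refine ⟨(hh.triflection _ hd)⁻¹, inv_mem (hh.triflection_mem hd), fun c hc => ?_, ?_⟩
    · rw [hh.triflection_inv_apply, hfix c hc]; simp
    · rw [hh.triflection_inv_apply, ha]; simp

/-- Roots with an inner product of positive real part are equal or differ by a root. -/
theorem eq_or_sub_root (hh : IsEisensteinForm h) {r s : M} (hr : h r r = 3) (hs : h s s = 3)
    (hpos : 0 < tr (h r s)) : r = s ∨ h (r - s) (r - s) = 3 := by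
  have h1 := hh.norm_sub r s
  rw [hr, hs] at h1
  simp at h1
  have h2 := three_dvd_tr (hh.theta_dvd r s)
  have h3 := hh.nonneg (r - s)
  -- The norm of `r - s` is 6 minus the trace, and the trace is a positive multiple of 3.
  have : tr (h r s) = 3 ∨ tr (h r s) = 6 := by omega
  rcases this with h4 | h4
  · right; rw [hh.self_eq_three_iff]; omega
  · left; exact sub_eq_zero.1 (hh.eq_zero_of_re (by omega))

/-- The vectors of `C` are orthogonal to `r - s`. One of them is not orthogonal to `s`, hence not to
`r`, so `r` cannot be proportional to `r - s`. -/
theorem conj_of_tr_pos (hh : IsEisensteinForm h) {C : Set M} {r s : M} (hr : h r r = 3)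
    (hs : h s s = 3) (hC : ∀ c ∈ C, h c r = h c s) (hex : ∃ c ∈ C, h c s ≠ 0)
    (hpos : 0 < tr (h r s)) : Conj h C r s := by
  rcases hh.eq_or_sub_root hr hs hpos with rfl | hd
  · exact Conj.refl C r
  · refine hh.conj_of_sub hr hs hd (fun H => ?_) hC
    obtain ⟨c, hc, hcs⟩ := hex
    have := congrArg (h c) H
    rw [hh.smul_right, hh.smul_right, hh.sub_right, hC c hc, sub_self, mul_zero] at this
    exact hcs ((mul_eq_zero.1 this).resolve_left fun h0 => by
      simpa using congrArg QuadraticAlgebra.re h0)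

end IsEisensteinForm

theorem eq_pow_of_nm_eq_one {u : EInt} (hu : nm u = 1) : ∃ k : ℕ, u = (-omega) ^ k := by
  obtain ⟨a, b⟩ := u
  simp only [nm] at hu
  have h1 : -1 ≤ a := by nlinarith [sq_nonneg (a - 2 * b)]
  have h2 : a ≤ 1 := by nlinarith [sq_nonneg (a - 2 * b)]
  have h3 : -1 ≤ b := by nlinarith [sq_nonneg (b - 2 * a)]
  have h4 : b ≤ 1 := by nlinarith [sq_nonneg (b - 2 * a)]
  interval_cases a <;> interval_cases b <;> first | (exfalso; omega) | skip
  · exact ⟨2, by ext <;> simp [omega, pow_succ]⟩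
  · exact ⟨3, by ext <;> simp [omega, pow_succ]⟩
  · exact ⟨1, by ext <;> simp [omega]⟩
  · exact ⟨4, by ext <;> simp [omega, pow_succ]⟩
  · exact ⟨0, by ext <;> simp⟩
  · exact ⟨5, by ext <;> simp [omega, pow_succ]⟩

namespace IsEisensteinForm

variable {M : Type*} [AddCommGroup M] [Module EInt M] {h : M → M → EInt}

/-- With nothing to keep fixed, non-proportionality of `r` and `r - s` must come from `nm (h r s) =
3`. If `3r = k(r - s)`, then `nm k = 9` and `tr k = 3`, so `nm (3 - k) = 9`, whereas pairing `(3 -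
k)r = -ks` with `s` gives 27. -/
theorem conj_of_nm_eq_three_of_tr_pos (hh : IsEisensteinForm h) {r s : M} (hr : h r r = 3)
    (hs : h s s = 3) (hnm : nm (h r s) = 3) (hpos : 0 < tr (h r s)) : Conj h ∅ r s := by
  rcases hh.eq_or_sub_root hr hs hpos with rfl | hd
  · exact Conj.refl _ _
  · refine hh.conj_of_sub hr hs hd (fun H => ?_) (by simp)
    have h0 := hh.norm_sub (r - s) r
    rw [show r - s - r = -s by abel, hh.neg_left, hh.neg_right, neg_neg, hs, hd, hr] at h0
    generalize h (r - s) r = k at *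
    have h1 : nm k = 9 := by
      have := congrArg (fun x => (h x x).re) H
      simp only [hh.smul_self, hr, hd] at this
      simp [nm] at this
      simp [nm]
      linarith
    have h2 : (3 - k) • r = -(k • s) := by rw [sub_smul, H, smul_sub]; abel
    have h3 := congrArg (fun x => nm (h x s)) h2
    simp only [hh.neg_left, hh.smul_left, hs, ← neg_mul, nm_mul, hnm, nm_star] at h3
    simp [nm, tr] at h0 h1 h3
    nlinarith

/-- Two roots whose inner product is a unit multiple of `θ` are conjugate, as are their
unit multiples. -/
theorem conj_smul_of_nm_eq_three (hh : IsEisensteinForm h) {r s : M} (hr : h r r = 3)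
    (hs : h s s = 3) (hnm : nm (h r s) = 3) {u : EInt} (hu : nm u = 1) :
    Conj h ∅ (u • r) s := by
  have hroot : ∀ η : EInt, nm η = 1 → h (η • r) (η • r) = 3 := fun η hη => by
    rw [hh.self_eq_three_iff, hh.smul_self, hη, hr]; rfl
  have hθ := hh.theta_mul_coord r s
  set a := hh.coord r s
  have ha : nm a = 1 := by
    rw [← hθ, nm_mul, nm_theta] at hnm
    omega
  have haa : star a * a = 1 := by rw [star_mul_self, ha]; rfl
  -- Normalising by `a` makes the product with `s` equal to `star c * θ`, whose trace is positive
  -- for `c = -ω²` and `c = ω`.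
  have direct : ∀ c : EInt, nm c = 1 → 0 < tr (star c * theta) → Conj h ∅ ((c * a) • r) s := by
    intro c hc hpos
    have hca : nm (c * a) = 1 := by rw [nm_mul, hc, ha]; rfl
    refine hh.conj_of_nm_eq_three_of_tr_pos (hroot _ hca) hs ?_ ?_
    · rw [hh.smul_left, nm_mul, nm_star, hca, hnm]; rfl
    · have : star (c * a) * (theta * a) = star c * theta * (star a * a) := by
        rw [star_mul]; ring
      rwa [hh.smul_left, ← hθ, this, haa, mul_one]
  have c1 := direct (-omega ^ 2) (by simp [nm, omega, pow_two])
    (by rw [theta_eq]; simp [tr, omega, pow_two])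
  have c2 := direct omega (by simp [nm, omega]) (by rw [theta_eq]; simp [tr, omega])
  -- The quotient of the two admissible units is `-ω`, which generates all units.
  have c3 : Conj h ∅ ((-omega) • r) r := by
    have := (c1.trans c2.symm).smul (star (omega * a))
    rw [← mul_smul, ← mul_smul] at this
    have e1 : star (omega * a) * (-omega ^ 2 * a) = -omega := by
      have : star (omega * a) * (-omega ^ 2 * a) = star omega * (-omega ^ 2) * (star a * a) := by
        rw [star_mul]; ring
      rw [this, haa]; ext <;> simp [omega, pow_two]
    have e2 : star (omega * a) * (omega * a) = 1 := by
      rw [star_mul_self, nm_mul, ha]; simp [nm, omega]; rfl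
    rwa [e1, e2, one_smul] at this
  have c4 : ∀ k : ℕ, Conj h ∅ ((-omega) ^ k • r) r := by
    intro k
    induction k with
    | zero => rw [pow_zero, one_smul]; exact Conj.refl _ _
    | succ k ih =>
      rw [pow_succ, mul_smul]
      exact (c3.smul _).trans ih
  have c5 : ∀ u : EInt, nm u = 1 → Conj h ∅ (u • r) r := fun u hu => by
    obtain ⟨k, rfl⟩ := eq_pow_of_nm_eq_one hu
    exact c4 k
  exact (c5 u hu).trans ((c5 (omega * a) (by rw [nm_mul, ha]; simp [nm, omega])).symm.trans c2)

/-- Two roots are orthogonal, or related as in `conj_smul_of_nm_eq_three`, or proportional. -/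
theorem root_trichotomy (hh : IsEisensteinForm h) {r s : M} (hr : h r r = 3) (hs : h s s = 3) :
    h r s = 0 ∨ nm (h r s) = 3 ∨ ∃ u : EInt, nm u = 1 ∧ s = u • r := by
  obtain ⟨hle, heq⟩ := hh.nm_le hr hs
  have hθ := hh.theta_mul_coord r s
  set a := hh.coord r s
  have h1 : nm (h r s) = 3 * nm a := by rw [← hθ, nm_mul, nm_theta]
  have h2 := nm_nonneg a
  -- The norm form `p² - pq + q²` does not represent 2.
  have h3 : nm a ≠ 2 := by
    intro H
    simp only [nm] at H
    obtain ⟨p, q⟩ := a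
    simp only at H
    have h1 : -1 ≤ p := by nlinarith [sq_nonneg (p - 2 * q)]
    have h2 : p ≤ 1 := by nlinarith [sq_nonneg (p - 2 * q)]
    have h3 : -1 ≤ q := by nlinarith [sq_nonneg (q - 2 * p)]
    have h4 : q ≤ 1 := by nlinarith [sq_nonneg (q - 2 * p)]
    interval_cases p <;> interval_cases q <;> omega
  have : nm a = 0 ∨ nm a = 1 ∨ nm a = 3 := by omega
  rcases this with H | H | H
  · left; rw [← hθ, nm_eq_zero.1 H, mul_zero]
  · right; left; omega
  · right; right
    have h4 := heq (by omega)
    have h5 : theta ∣ a := by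
      have : (3 : ℤ) ∣ (a.re + a.im) ^ 2 :=
        ⟨1 + a.re * a.im, by simp only [nm] at H; linarith⟩
      exact theta_dvd_of_three_dvd (Int.prime_three.dvd_of_dvd_pow this)
    obtain ⟨b, hb⟩ := h5
    have h6 : h r s = 3 * -b := by rw [← hθ, hb, ← mul_assoc, theta_sq]; ring
    refine ⟨-b, ?_, ?_⟩
    · have : nm (h r s) = 9 * nm (-b) := by rw [h6, nm_mul]; rfl
      omega
    · rw [h6, mul_smul] at h4
      exact hh.smul_cancel (by intro h0; simpa using congrArg QuadraticAlgebra.re h0) h4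

end IsEisensteinForm

/-! ### Positivity and basis roots of the lattices `𝓔ₙ` -/

theorem isEisensteinForm_gramForm {n : Type*} [Fintype n] {B : Matrix n n EInt}
    (hB : ∀ i j, star (B i j) = B j i) (hθ : ∀ i j, theta ∣ B i j)
    (hpos : ∀ x, (gramForm B x x).re ≤ 0 → x = 0) : IsEisensteinForm (gramForm B) where
  add_right x y z := by simp [gramForm, Matrix.mulVec_add]
  smul_right c x y := by simp [gramForm, Matrix.mulVec_smul]
  star_eq x y := by
    simp only [gramForm, dotProduct, Matrix.mulVec, star_sum, star_mul, Pi.star_apply,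
      star_star, Finset.mul_sum]
    rw [Finset.sum_comm]
    refine Finset.sum_congr rfl fun i _ => Finset.sum_congr rfl fun j _ => ?_
    rw [hB]; ring
  theta_dvd x y := by
    refine Finset.dvd_sum fun i _ => Dvd.dvd.mul_left ?_ _
    exact Finset.dvd_sum fun j _ => Dvd.dvd.mul_right (hθ i j) _
  pos x hx := by
    by_contra H
    exact hx (hpos x (not_lt.1 H))

theorem star_gram (n : ℕ) (i j : Fin n) : star (gram n i j) = gram n j i := by
  simp only [gram, Matrix.of_apply, eq_comm (a := j)]
  split_ifs <;> first | omega | simp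

theorem theta_dvd_gram (n : ℕ) (i j : Fin n) : theta ∣ gram n i j := by
  simp only [gram, Matrix.of_apply]
  split_ifs
  · exact ⟨-theta, by rw [mul_neg, theta_sq, neg_neg]⟩
  · exact dvd_rfl
  · rw [star_theta]; exact ⟨-1, by ring⟩
  · exact dvd_zero _

theorem isEisensteinForm_form_one : IsEisensteinForm (form 1) := by
  refine isEisensteinForm_gramForm (star_gram 1) (theta_dvd_gram 1) fun x hx => ?_
  have key : (gramForm (gram 1) x x).re = 3 * nm (x 0) := by
    simp [gramForm, dotProduct, Matrix.mulVec, gram, nm]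
    ring
  have h0 := nm_nonneg (x 0)
  have h1 : x 0 = 0 := nm_eq_zero.1 (by omega)
  ext i : 1
  fin_cases i
  exact h1

theorem eq_zero_of_triangular (c : ℤ) {x y : EInt} (d : EInt) (hc : c ≠ 0)
    (hx : nm (⟨c, 0⟩ * x + d * y) = 0) (hy : y = 0) : x = 0 := by
  rw [nm_eq_zero, hy, mul_zero, add_zero] at hx
  refine (mul_eq_zero.1 hx).resolve_left fun h => hc ?_
  exact congrArg QuadraticAlgebra.re h

theorem isEisensteinForm_form_three : IsEisensteinForm (form 3) := by
  refine isEisensteinForm_gramForm (star_gram 3) (theta_dvd_gram 3) fun x hx => ?_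
  -- Completing squares, with denominators cleared. The system is triangular, so the coordinates
  -- vanish from the last to the first.
  have key : 6 * (gramForm (gram 3) x x).re = 2 * nm (⟨3, 0⟩ * x 0 + theta * x 1) +
      3 * nm (⟨2, 0⟩ * x 1 + theta * x 2) + 9 * nm (x 2) := by
    simp [gramForm, dotProduct, Matrix.mulVec, gram, nm, Fin.sum_univ_three, theta_eq]
    ring
  have h0 := nm_nonneg (⟨3, 0⟩ * x 0 + theta * x 1)
  have h1 := nm_nonneg (⟨2, 0⟩ * x 1 + theta * x 2)
  have h2 := nm_nonneg (x 2)
  have e2 : x 2 = 0 := nm_eq_zero.1 (by omega)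
  have e1 : x 1 = 0 := eq_zero_of_triangular 2 theta (by norm_num) (by omega) e2
  have e0 : x 0 = 0 := eq_zero_of_triangular 3 theta (by norm_num) (by omega) e1
  ext i : 1
  fin_cases i
  exacts [e0, e1, e2]

theorem isEisensteinForm_form_four : IsEisensteinForm (form 4) := by
  refine isEisensteinForm_gramForm (star_gram 4) (theta_dvd_gram 4) fun x hx => ?_
  have key : 6 * (gramForm (gram 4) x x).re = 2 * nm (⟨3, 0⟩ * x 0 + theta * x 1) +
      3 * nm (⟨2, 0⟩ * x 1 + theta * x 2) + nm (⟨3, 0⟩ * x 2 + ⟨2, 0⟩ * theta * x 3) +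
      6 * nm (x 3) := by
    simp [gramForm, dotProduct, Matrix.mulVec, gram, nm, Fin.sum_univ_four, theta_eq]
    ring
  have h0 := nm_nonneg (⟨3, 0⟩ * x 0 + theta * x 1)
  have h1 := nm_nonneg (⟨2, 0⟩ * x 1 + theta * x 2)
  have h2 := nm_nonneg (⟨3, 0⟩ * x 2 + ⟨2, 0⟩ * theta * x 3)
  have h3 := nm_nonneg (x 3)
  have e3 : x 3 = 0 := nm_eq_zero.1 (by omega)
  have e2 : x 2 = 0 := eq_zero_of_triangular 3 (⟨2, 0⟩ * theta) (by norm_num) (by omega) e3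
  have e1 : x 1 = 0 := eq_zero_of_triangular 2 theta (by norm_num) (by omega) e2
  have e0 : x 0 = 0 := eq_zero_of_triangular 3 theta (by norm_num) (by omega) e1
  ext i : 1
  fin_cases i
  exacts [e0, e1, e2, e3]

/-- The standard basis of `𝓔ₙ`, which consists of roots. -/
def root {n : ℕ} (i : Fin n) : Fin n → EInt := Pi.single i 1

theorem form_root_root {n : ℕ} (i j : Fin n) : form n (root i) (root j) = gram n i j := by
  simp [form, gramForm, root, Pi.star_single]

theorem form_root_self {n : ℕ} (i : Fin n) : form n (root i) (root i) = 3 := by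
  simp [form_root_root, gram]

theorem eq_sum_root {n : ℕ} (x : Fin n → EInt) : x = ∑ i, x i • root i := by
  ext j : 1
  simp [root, Finset.sum_apply, Pi.single_apply]

theorem form_root_succ {n : ℕ} {i j : Fin n} (hij : (i : ℕ) + 1 = j) :
    form n (root i) (root j) = theta := by
  rw [form_root_root]
  simp only [gram, Matrix.of_apply]
  rw [if_neg (by intro h; subst h; omega), if_pos hij]

theorem form_root_pred {n : ℕ} {i j : Fin n} (hij : (j : ℕ) + 1 = i) :
    form n (root i) (root j) = star theta := by
  rw [form_root_root]
  simp only [gram, Matrix.of_apply]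
  rw [if_neg (by intro h; subst h; omega), if_neg (by omega), if_pos hij]

theorem form_root_of_far {n : ℕ} {i j : Fin n} (hij : (i : ℕ) + 1 < j ∨ (j : ℕ) + 1 < i) :
    form n (root i) (root j) = 0 := by
  rw [form_root_root]
  simp only [gram, Matrix.of_apply]
  rw [if_neg (by intro h; subst h; omega), if_neg (by omega), if_neg (by omega)]

/-! ### Transitivity of the reflection group on chains of roots -/

variable {n : ℕ}

theorem exists_form_root_ne_zero (hh : IsEisensteinForm (form n)) {r : Fin n → EInt}
    (hr : r ≠ 0) : ∃ i, form n r (root i) ≠ 0 := by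
  by_contra! H
  have : form n r r = 0 := by
    nth_rw 2 [eq_sum_root r]
    rw [hh.sum_right]
    exact Finset.sum_eq_zero fun i _ => by rw [hh.smul_right, H i, mul_zero]
  have h2 := hh.pos r hr
  rw [this] at h2
  simp at h2

/-- For `n ≥ 2` the reflection group acts transitively on the roots of `𝓔ₙ`. -/
theorem conj_root_zero (hh : IsEisensteinForm (form (n + 2))) {r : Fin (n + 2) → EInt}
    (hr : form (n + 2) r r = 3) : IsEisensteinForm.Conj (form (n + 2)) ∅ r (root 0) := by
  have step : ∀ {i j : Fin (n + 2)} {u : EInt}, nm u = 1 → (i : ℕ) + 1 = j ∨ (j : ℕ) + 1 = i →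
      IsEisensteinForm.Conj (form (n + 2)) ∅ (u • root i) (root j) := by
    intro i j u hu hij
    refine hh.conj_smul_of_nm_eq_three (form_root_self i) (form_root_self j) ?_ hu
    rcases hij with hij | hij
    · rw [form_root_succ hij, nm_theta]
    · rw [form_root_pred hij, nm_star, nm_theta]
  -- Each move to a neighbour in the chain absorbs the unit. At `root 0` the unit is removed by
  -- going to `root 1` and back, which is where rank at least 2 is needed.
  have unit : ∀ (k : ℕ) (hk : k < n + 2) (u : EInt), nm u = 1 →
      IsEisensteinForm.Conj (form (n + 2)) ∅ (u • root ⟨k, hk⟩) (root 0) := by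
    intro k
    induction k with
    | zero =>
      intro hk u hu
      refine (step (j := 1) hu (by left; rfl)).trans ?_
      have := step (i := 1) (j := 0) (u := 1) (by simp [nm]) (by right; rfl)
      rwa [one_smul] at this
    | succ k ih =>
      intro hk u hu
      refine (step (j := ⟨k, by omega⟩) hu (by right; rfl)).trans ?_
      have := ih (by omega) 1 (by simp [nm])
      rwa [one_smul] at this
  obtain ⟨i, hi⟩ := exists_form_root_ne_zero hh (hh.ne_zero_of_root hr)
  rcases hh.root_trichotomy hr (form_root_self i) with h | h | ⟨u, hu, h⟩
  · exact absurd h hi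
  · have h1 := hh.conj_smul_of_nm_eq_three hr (form_root_self i) h (u := 1) (by simp [nm])
    rw [one_smul] at h1
    have h2 := unit i i.2 1 (by simp [nm])
    rw [one_smul] at h2
    exact h1.trans h2
  · have h1 := unit i i.2 (star u) (by rw [nm_star, hu])
    change IsEisensteinForm.Conj _ _ (star u • root i) _ at h1
    rwa [h, ← mul_smul, star_mul_self, hu, show (⟨1, 0⟩ : EInt) = 1 from rfl, one_smul] at h1

namespace IsEisensteinForm

variable {M : Type*} [AddCommGroup M] [Module EInt M] {h : M → M → EInt}

theorem flip_eq (hh : IsEisensteinForm h) {x y : M} {c : EInt} (H : h x y = c) :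
    h y x = star c := by rw [← hh.star_eq, H]

/-- In a lattice containing `𝓔₃`, the stabilizer of the first root is transitive on the roots
that can follow it in a chain. -/
theorem conj_second (hh : IsEisensteinForm h) {e₁ e₂ e₃ r : M} (h₁ : h e₁ e₁ = 3)
    (h₂ : h e₂ e₂ = 3) (h₃ : h e₃ e₃ = 3) (h₁₂ : h e₁ e₂ = theta) (h₂₃ : h e₂ e₃ = theta)
    (h₁₃ : h e₁ e₃ = 0) (hr : h r r = 3) (h₁r : h e₁ r = theta) : Conj h {e₁} r e₂ := by
  have h₂₁ := hh.flip_eq h₁₂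
  have h₃₂ := hh.flip_eq h₂₃
  have hr₁ := hh.flip_eq h₁r
  have adj : ∀ {x y : M}, h x x = 3 → h y y = 3 → h e₁ x = theta → h e₁ y = theta →
      0 < tr (h x y) → Conj h {e₁} x y := fun hx hy h1x h1y hpos =>
    hh.conj_of_tr_pos hx hy (by simp [h1x, h1y]) ⟨e₁, rfl, by rw [h1y]; exact theta_ne_zero⟩ hpos
  -- The other candidates in the plane of `e₁, e₂` reach `e₂` through the intermediate root `e₂ +
  -- γe₃`.
  have twist : ∀ {α β γ : EInt},
      h (α • e₁ + β • e₂) (α • e₁ + β • e₂) = 3 → h e₁ (α • e₁ + β • e₂) = theta →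
      h (e₂ + γ • e₃) (e₂ + γ • e₃) = 3 → 0 < tr (h (α • e₁ + β • e₂) (e₂ + γ • e₃)) →
      0 < tr (h (e₂ + γ • e₃) e₂) → Conj h {e₁} (α • e₁ + β • e₂) e₂ := by
    intro α β γ k1 k2 k3 k4 k5
    have k6 : h e₁ (e₂ + γ • e₃) = theta := by
      rw [hh.add_right, hh.smul_right, h₁₂, h₁₃, mul_zero, add_zero]
    exact (adj k1 k3 k2 k6 k4).trans (adj k3 h₂ k6 h₁₂ k5)
  have c1 : Conj h {e₁} ((-omega ^ 2) • e₁ + omega • e₂) e₂ := by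
    apply twist (γ := -omega ^ 2) <;>
      simp only [hh.add_left, hh.add_right, hh.smul_left, hh.smul_right, h₁, h₂, h₃, h₁₂, h₂₃,
        h₁₃, h₂₁, h₃₂] <;> decide
  have c2 : Conj h {e₁} (omega • e₁ + (omega ^ 2) • e₂) e₂ := by
    apply twist (γ := omega) <;>
      simp only [hh.add_left, hh.add_right, hh.smul_left, hh.smul_right, h₁, h₂, h₃, h₁₂, h₂₃,
        h₁₃, h₂₁, h₃₂] <;> decide
  -- The three candidates add up to `θe₁`, whose product with `r` is 3.
  have hsum : tr (h r e₂) + tr (h r ((-omega ^ 2) • e₁ + omega • e₂)) +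
      tr (h r (omega • e₁ + (omega ^ 2) • e₂)) = 6 := by
    simp only [hh.add_right, hh.smul_right, hr₁]
    rw [theta_eq]
    simp [tr, omega, pow_two]
    ring
  have : 0 < tr (h r e₂) ∨ 0 < tr (h r ((-omega ^ 2) • e₁ + omega • e₂)) ∨
      0 < tr (h r (omega • e₁ + (omega ^ 2) • e₂)) := by omega
  rcases this with hp | hp | hp
  · exact adj hr h₂ h₁r h₁₂ hp
  · refine (adj hr ?_ h₁r ?_ hp).trans c1 <;>
      simp only [hh.add_left, hh.add_right, hh.smul_left, hh.smul_right, h₁, h₂, h₁₂, h₂₁] <;>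
      decide
  · refine (adj hr ?_ h₁r ?_ hp).trans c2 <;>
      simp only [hh.add_left, hh.add_right, hh.smul_left, hh.smul_right, h₁, h₂, h₁₂, h₂₁] <;>
      decide

/-- In a lattice containing `𝓔₄`, the stabilizer of the first two roots is transitive on the roots
that can follow them in a chain. -/
theorem conj_third (hh : IsEisensteinForm h) {e₁ e₂ e₃ e₄ r : M} (h₁ : h e₁ e₁ = 3)
    (h₂ : h e₂ e₂ = 3) (h₃ : h e₃ e₃ = 3) (h₄ : h e₄ e₄ = 3) (h₁₂ : h e₁ e₂ = theta)
    (h₂₃ : h e₂ e₃ = theta) (h₃₄ : h e₃ e₄ = theta) (h₁₃ : h e₁ e₃ = 0) (h₁₄ : h e₁ e₄ = 0)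
    (h₂₄ : h e₂ e₄ = 0) (hr : h r r = 3) (h₁r : h e₁ r = 0) (h₂r : h e₂ r = theta) :
    Conj h {e₁, e₂} r e₃ := by
  have h₂₁ := hh.flip_eq h₁₂
  have h₃₂ := hh.flip_eq h₂₃
  have h₄₃ := hh.flip_eq h₃₄
  have h₃₁ := hh.flip_eq h₁₃
  have hr₁ := hh.flip_eq h₁r
  have hr₂ := hh.flip_eq h₂r
  have adj : ∀ {x y : M}, h x x = 3 → h y y = 3 → h e₁ x = 0 → h e₁ y = 0 → h e₂ x = theta →
      h e₂ y = theta → 0 < tr (h x y) → Conj h {e₁, e₂} x y :=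
    fun hx hy h1x h1y h2x h2y hpos => hh.conj_of_tr_pos hx hy (by simp [h1x, h1y, h2x, h2y])
      ⟨e₂, by simp, by rw [h2y]; exact theta_ne_zero⟩ hpos
  have c1 : Conj h {e₁, e₂} (e₁ + theta • e₂ + (-1 : EInt) • e₃) (e₃ + omega • e₄) := by
    apply adj <;>
      simp only [hh.add_left, hh.add_right, hh.smul_left, hh.smul_right, h₁, h₂, h₃, h₄, h₁₂,
        h₂₃, h₃₄, h₁₃, h₁₄, h₂₄, h₂₁, h₃₂, h₄₃, h₃₁] <;> decide
  have c2 : Conj h {e₁, e₂} (e₃ + omega • e₄) e₃ := by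
    apply adj <;>
      simp only [hh.add_left, hh.add_right, hh.smul_left, hh.smul_right, h₃, h₄,
        h₂₃, h₃₄, h₁₃, h₁₄, h₂₄, h₄₃] <;> decide
  -- The two candidates add up to `e₁ + θe₂`. The second reaches `e₃` only through `e₃ + ωe₄`, hence
  -- the need for `e₄`.
  have hsum : tr (h r e₃) + tr (h r (e₁ + theta • e₂ + (-1 : EInt) • e₃)) = 6 := by
    simp only [hh.add_right, hh.smul_right, hr₁, hr₂]
    rw [theta_eq]
    simp [tr]
    ring
  have : 0 < tr (h r e₃) ∨ 0 < tr (h r (e₁ + theta • e₂ + (-1 : EInt) • e₃)) := by omega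
  rcases this with hp | hp
  · exact adj hr h₃ h₁r h₁₃ h₂r h₂₃ hp
  · refine (adj hr ?_ h₁r ?_ h₂r ?_ hp).trans (c1.trans c2) <;>
      simp only [hh.add_left, hh.add_right, hh.smul_left, hh.smul_right, h₁, h₂, h₃, h₁₂,
        h₂₃, h₁₃, h₂₁, h₃₂, h₃₁] <;> decide

/-- In a lattice containing `𝓔₄`, the stabilizer of the first three roots is transitive on the
roots that can follow them in a chain. -/
theorem conj_fourth (hh : IsEisensteinForm h) {e₁ e₂ e₃ e₄ r : M} (h₁ : h e₁ e₁ = 3)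
    (h₂ : h e₂ e₂ = 3) (h₃ : h e₃ e₃ = 3) (h₄ : h e₄ e₄ = 3) (h₁₂ : h e₁ e₂ = theta)
    (h₂₃ : h e₂ e₃ = theta) (h₃₄ : h e₃ e₄ = theta) (h₁₃ : h e₁ e₃ = 0) (h₁₄ : h e₁ e₄ = 0)
    (h₂₄ : h e₂ e₄ = 0) (hr : h r r = 3) (h₁r : h e₁ r = 0) (h₂r : h e₂ r = 0)
    (h₃r : h e₃ r = theta) : Conj h {e₁, e₂, e₃} r e₄ := by
  have h₂₁ := hh.flip_eq h₁₂
  have h₃₂ := hh.flip_eq h₂₃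
  have h₄₃ := hh.flip_eq h₃₄
  have h₃₁ := hh.flip_eq h₁₃
  have h₄₁ := hh.flip_eq h₁₄
  have h₄₂ := hh.flip_eq h₂₄
  have hr₁ := hh.flip_eq h₁r
  have hr₂ := hh.flip_eq h₂r
  have hr₃ := hh.flip_eq h₃r
  have adj : ∀ {x y : M}, h x x = 3 → h y y = 3 → h e₁ x = 0 → h e₁ y = 0 → h e₂ x = 0 →
      h e₂ y = 0 → h e₃ x = theta → h e₃ y = theta → 0 < tr (h x y) → Conj h {e₁, e₂, e₃} x y :=
    fun hx hy h1x h1y h2x h2y h3x h3y hpos =>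
      hh.conj_of_tr_pos hx hy (by simp [h1x, h1y, h2x, h2y, h3x, h3y])
        ⟨e₃, by simp, by rw [h3y]; exact theta_ne_zero⟩ hpos
  set t₁ : M := omega ^ 2 • e₁ + (1 - omega) • e₂ + (-2 * omega ^ 2) • e₃ + omega • e₄ with ht₁
  set t₂ : M := (-omega) • e₁ + (1 - omega ^ 2) • e₂ + (2 * omega) • e₃ + omega ^ 2 • e₄ with ht₂
  -- The coefficients `1, ω, ω²` of `e₄` cancel: the sum is `-θe₁ + 3e₂ + 2θe₃`, whose product with
  -- `r` is 6.
  have hsum : tr (h r e₄) + tr (h r t₁) + tr (h r t₂) = 12 := by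
    simp only [ht₁, ht₂, hh.add_right, hh.smul_right, hr₁, hr₂, hr₃]
    rw [theta_eq]
    simp [tr, omega, pow_two]
    ring
  have : 0 < tr (h r e₄) ∨ 0 < tr (h r t₁) ∨ 0 < tr (h r t₂) := by omega
  rcases this with hp | hp | hp
  · exact adj hr h₄ h₁r h₁₄ h₂r h₂₄ h₃r h₃₄ hp
  · refine (adj hr ?_ h₁r ?_ h₂r ?_ h₃r ?_ hp).trans (adj ?_ h₄ ?_ h₁₄ ?_ h₂₄ ?_ h₃₄ ?_) <;>
      simp only [ht₁, hh.add_left, hh.add_right, hh.smul_left, hh.smul_right, h₁, h₂, h₃, h₄, h₁₂,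
        h₂₃, h₃₄, h₁₃, h₁₄, h₂₄, h₂₁, h₃₂, h₄₃, h₃₁, h₄₁, h₄₂] <;> decide
  · refine (adj hr ?_ h₁r ?_ h₂r ?_ h₃r ?_ hp).trans (adj ?_ h₄ ?_ h₁₄ ?_ h₂₄ ?_ h₃₄ ?_) <;>
      simp only [ht₂, hh.add_left, hh.add_right, hh.smul_left, hh.smul_right, h₁, h₂, h₃, h₄, h₁₂,
        h₂₃, h₃₄, h₁₃, h₁₄, h₂₄, h₂₁, h₃₂, h₄₃, h₃₁, h₄₁, h₄₂] <;> decide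

end IsEisensteinForm

/-! ### The reflection groups of `𝓔₄` and `𝓔₃` -/

section
variable {M : Type*} [AddCommGroup M] [Module EInt M] {h : M → M → EInt}

/-- The inductive step along the chain: a factor from `W` enlarges the fixed set `C` by `x`. -/
theorem IsEisensteinForm.Conj.exists_mul {C : Set M} {x : M} {φ : isometryGroup h}
    (hC : ∀ c ∈ C, φ.1 c = c) (hx : Conj h C (φ.1 x) x) :
    ∃ w ∈ weylGroup h, (∀ c ∈ C, (w * φ).1 c = c) ∧ (w * φ).1 x = x := by
  obtain ⟨w, hw, hc, hwx⟩ := hx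
  refine ⟨w, hw, fun c h => ?_, hwx⟩
  change w.1 (φ.1 c) = c
  rw [hC c h, hc c h]

theorem isometryGroup_inner (φ : isometryGroup h) {x y : M} (hx : φ.1 x = x) :
    h x (φ.1 y) = h x y := by
  have := φ.2 x y
  rwa [hx] at this

theorem mem_weylGroup_of_mul {w φ : isometryGroup h} (hw : w ∈ weylGroup h)
    (H : w * φ ∈ weylGroup h) : φ ∈ weylGroup h := by
  have := mul_mem (inv_mem hw) H
  rwa [inv_mul_cancel_left] at this

/-- The reflection group acts trivially modulo `θ` on a vector whose inner products are divisible
by `3`. -/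
theorem weylGroup_apply_sub_dvd (hh : IsEisensteinForm h) {v : M} (hv : ∀ x, 3 ∣ h x v)
    {w : isometryGroup h} (hw : w ∈ weylGroup h) : ∃ y, w.1 v = v + theta • y := by
  induction hw using Subgroup.closure_induction with
  | mem φ hφ =>
    obtain ⟨r, hr⟩ := hφ
    obtain ⟨b, hb⟩ := hv r
    rw [hh.eq_triflection hr, hh.triflection_apply]
    have : hh.coord r v = theta * -b := by
      apply mul_left_cancel₀ theta_ne_zero
      rw [hh.theta_mul_coord, hb, ← mul_assoc, theta_sq]
      ring
    exact ⟨(omega ^ 2 * -b) • r, by rw [this, ← mul_smul]; congr 2; ring⟩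
  | one => exact ⟨0, by simp⟩
  | mul a b _ _ ha hb =>
    obtain ⟨y, hy⟩ := ha
    obtain ⟨z, hz⟩ := hb
    refine ⟨y + a.1 z, ?_⟩
    change a.1 (b.1 v) = _
    rw [hz, map_add, map_smul, hy, smul_add, add_assoc]
  | inv a _ ha =>
    obtain ⟨y, hy⟩ := ha
    refine ⟨-a.1.symm y, ?_⟩
    change a.1.symm v = _
    rw [LinearEquiv.symm_apply_eq, map_add, hy, map_smul, map_neg, LinearEquiv.apply_symm_apply,
      smul_neg, add_neg_cancel_right]

end

theorem isometryGroup_ext {n : ℕ} {φ : isometryGroup (form n)}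
    (H : ∀ i, φ.1 (root i) = root i) : φ = 1 := by
  apply Subtype.ext
  ext x : 1
  change φ.1 x = x
  rw [eq_sum_root x, map_sum]
  simp only [map_smul, H]

theorem weylGroup_form_four : weylGroup (form 4) = ⊤ := by
  have hh := isEisensteinForm_form_four
  have g₁₂ : form 4 (root 0) (root 1) = theta := form_root_succ rfl
  have g₂₃ : form 4 (root 1) (root 2) = theta := form_root_succ rfl
  have g₃₄ : form 4 (root 2) (root 3) = theta := form_root_succ rfl
  have g₁₃ : form 4 (root 0) (root 2) = 0 := form_root_of_far (by left; decide)
  have g₁₄ : form 4 (root 0) (root 3) = 0 := form_root_of_far (by left; decide)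
  have g₂₄ : form 4 (root 1) (root 3) = 0 := form_root_of_far (by left; decide)
  rw [eq_top_iff]
  intro φ _
  obtain ⟨w, hw, -, k0⟩ := (conj_root_zero hh ((φ.2 _ _).trans (form_root_self 0))).exists_mul
    (φ := φ) (by simp)
  refine mem_weylGroup_of_mul hw ?_
  generalize w * φ = φ at k0
  obtain ⟨w, hw, hc, k1⟩ := (hh.conj_second (form_root_self 0) (form_root_self 1)
    (form_root_self 2) g₁₂ g₂₃ g₁₃ ((φ.2 _ _).trans (form_root_self 1))
    ((isometryGroup_inner φ k0).trans g₁₂)).exists_mul (φ := φ) (by simpa using k0)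
  refine mem_weylGroup_of_mul hw ?_
  generalize w * φ = φ at hc k1
  simp only [Set.mem_singleton_iff, forall_eq] at hc
  obtain ⟨w, hw, hc', k2⟩ := (hh.conj_third (form_root_self 0) (form_root_self 1)
    (form_root_self 2) (form_root_self 3) g₁₂ g₂₃ g₃₄ g₁₃ g₁₄ g₂₄
    ((φ.2 _ _).trans (form_root_self 2)) ((isometryGroup_inner φ hc).trans g₁₃)
    ((isometryGroup_inner φ k1).trans g₂₃)).exists_mul (φ := φ) (by simp [hc, k1])
  refine mem_weylGroup_of_mul hw ?_
  generalize w * φ = φ at hc' k2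
  simp only [Set.mem_insert_iff, Set.mem_singleton_iff, forall_eq_or_imp, forall_eq] at hc'
  obtain ⟨w, hw, hc'', k3⟩ := (hh.conj_fourth (form_root_self 0) (form_root_self 1)
    (form_root_self 2) (form_root_self 3) g₁₂ g₂₃ g₃₄ g₁₃ g₁₄ g₂₄
    ((φ.2 _ _).trans (form_root_self 3)) ((isometryGroup_inner φ hc'.1).trans g₁₄)
    ((isometryGroup_inner φ hc'.2).trans g₂₄)
    ((isometryGroup_inner φ k2).trans g₃₄)).exists_mul (φ := φ) (by simp [hc'.1, hc'.2, k2])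
  refine mem_weylGroup_of_mul hw ?_
  generalize w * φ = φ at hc'' k3
  simp only [Set.mem_insert_iff, Set.mem_singleton_iff, forall_eq_or_imp, forall_eq] at hc''
  rw [isometryGroup_ext (φ := φ)]
  · exact one_mem _
  · intro i
    fin_cases i
    exacts [hc''.1, hc''.2.1, hc''.2.2, k3]

theorem three_ne_zero_eint : (3 : EInt) ≠ 0 := fun h => by
  simpa using congrArg QuadraticAlgebra.re h

/-- The orthogonal complement of the first two roots of `𝓔₃` contains no roots. -/
theorem form_three_self_ne {d : Fin 3 → EInt} (h0 : form 3 (root 0) d = 0)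
    (h1 : form 3 (root 1) d = 0) : form 3 d d ≠ 3 := by
  have hh := isEisensteinForm_form_three
  rw [eq_sum_root d] at h0 h1
  simp only [Fin.sum_univ_three, hh.add_right, hh.smul_right, form_root_self] at h0 h1
  rw [form_root_succ (by rfl), form_root_of_far (by left; decide)] at h0
  rw [form_root_pred (i := 1) (j := 0) rfl, form_root_succ (i := 1) (j := 2) rfl,
    star_theta] at h1
  have e1 : d 1 = theta * d 0 := by
    apply mul_left_cancel₀ three_ne_zero_eint
    linear_combination (-theta) * h0 + d 1 * theta_sq
  have e2 : d 2 = -2 * d 0 := by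
    apply mul_left_cancel₀ theta_ne_zero
    rw [e1] at h1
    linear_combination h1
  -- The complement of the first two roots is spanned by a vector of norm 6, so its norms are
  -- multiples of 6.
  have hd : d = d 0 • ![1, theta, -2] := by
    ext i : 1
    fin_cases i
    · simp
    · simp [e1, mul_comm]
    · simp [e2, mul_comm]
  intro H
  have h3 := hh.smul_self (d 0) ![1, theta, -2]
  rw [← hd, H, show (form 3 ![1, theta, -2] ![1, theta, -2]).re = 6 by decide] at h3
  simp at h3
  omega

/-- `θ` times a generator of the dual of `𝓔₃` modulo `𝓔₃`. -/
def dualVector : Fin 3 → EInt := ![1, 0, 1]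

theorem dualVector_eq : dualVector = root 0 + root 2 := by decide

theorem three_dvd_form_dualVector (x : Fin 3 → EInt) : 3 ∣ form 3 x dualVector := by
  refine ⟨star (x 0) + star (x 2), ?_⟩
  simp [form, gramForm, dualVector, dotProduct, Matrix.mulVec, Fin.sum_univ_three, gram,
    star_theta]
  ring

/-- The first coordinate would make 2 a multiple of `θ`, but its norm 4 is prime to 3. So the signs
`±1` modulo `θ` are distinct. -/
theorem dualVector_ne {y : Fin 3 → EInt} : dualVector ≠ -dualVector + theta • y := by
  intro H
  have h0 : (1 : EInt) = -1 + theta * y 0 := congrFun H 0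
  have : nm (theta * y 0) = nm 2 := by
    congr 1
    linear_combination -h0
  rw [nm_mul, nm_theta] at this
  simp [nm] at this
  omega

/-- Two roots can be fixed as in `𝓔₄`, but no fourth root links the two candidates `root 2` and `a`
for the image of the third; the second candidate gives sign `-1`. -/
theorem exists_weylGroup_mul (φ : isometryGroup (form 3)) :
    φ ∈ weylGroup (form 3) ∨ ∃ w ∈ weylGroup (form 3), ∃ y,
      (w * φ).1 dualVector = -dualVector + theta • y := by
  have hh := isEisensteinForm_form_three
  have g₁₂ : form 3 (root 0) (root 1) = theta := form_root_succ rfl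
  have g₂₃ : form 3 (root 1) (root 2) = theta := form_root_succ rfl
  have g₁₃ : form 3 (root 0) (root 2) = 0 := form_root_of_far (by left; decide)
  obtain ⟨w, hw, -, k0⟩ := (conj_root_zero hh ((φ.2 _ _).trans (form_root_self 0))).exists_mul
    (φ := φ) (by simp)
  obtain ⟨w', hw', hc, k1⟩ := (hh.conj_second (form_root_self 0) (form_root_self 1)
    (form_root_self 2) g₁₂ g₂₃ g₁₃ (((w * φ).2 _ _).trans (form_root_self 1))
    ((isometryGroup_inner (w * φ) k0).trans g₁₂)).exists_mul (φ := w * φ) (by simpa using k0)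
  simp only [Set.mem_singleton_iff, forall_eq] at hc
  rw [← mul_assoc] at hc k1
  have hw'' := mul_mem hw' hw
  generalize w' * w = w'' at hw'' hc k1
  set r := (w'' * φ).1 (root 2) with hr
  have hr₁ : form 3 (root 0) r = 0 := (isometryGroup_inner _ hc).trans g₁₃
  have hr₂ : form 3 (root 1) r = theta := (isometryGroup_inner _ k1).trans g₂₃
  have hrr : form 3 r r = 3 := ((w'' * φ).2 _ _).trans (form_root_self 2)
  set a : Fin 3 → EInt := root 0 + theta • root 1 + (-1 : EInt) • root 2 with ha
  have ha0 : form 3 (root 0) a = 0 := by decide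
  have ha1 : form 3 (root 1) a = theta := by decide
  have haa : form 3 a a = 3 := by decide
  have hsum : tr (form 3 r (root 2)) + tr (form 3 r a) = 6 := by
    simp only [ha, hh.add_right, hh.smul_right, hh.flip_eq hr₁, hh.flip_eq hr₂]
    rw [theta_eq]
    simp [tr]
    ring
  -- Otherwise `r` differs from a candidate by a root orthogonal to the first two roots, and there
  -- is none.
  have hor : r = root 2 ∨ r = a := by
    have : 0 < tr (form 3 r (root 2)) ∨ 0 < tr (form 3 r a) := by omega
    rcases this with hp | hp
    · refine (hh.eq_or_sub_root hrr (form_root_self 2) hp).imp_right fun hd => ?_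
      exact absurd hd (form_three_self_ne (by rw [hh.sub_right, hr₁, g₁₃, sub_self])
        (by rw [hh.sub_right, hr₂, g₂₃, sub_self]))
    · refine (hh.eq_or_sub_root hrr haa hp).symm.imp_left fun hd => ?_
      exact absurd hd (form_three_self_ne (by rw [hh.sub_right, hr₁, ha0, sub_self])
        (by rw [hh.sub_right, hr₂, ha1, sub_self]))
  rcases hor with H | H
  · left
    refine mem_weylGroup_of_mul hw'' ?_
    rw [isometryGroup_ext (φ := w'' * φ)]
    · exact one_mem _
    · intro i
      fin_cases i
      exacts [hc, k1, H]
  · right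
    -- The image of `d` is `root 0 + a = -d + 3 • root 0 + θ • root 1`, and `3 = θ * -θ`.
    refine ⟨w'', hw'', ![-theta, 1, 0], ?_⟩
    rw [dualVector_eq, map_add, hc, ← hr, H]
    decide

theorem apply_dualVector_of_mem {φ : isometryGroup (form 3)} (hφ : φ ∈ weylGroup (form 3)) :
    ∃ y, φ.1 dualVector = dualVector + theta • y :=
  weylGroup_apply_sub_dvd isEisensteinForm_form_three three_dvd_form_dualVector hφ

theorem apply_dualVector_of_notMem {φ : isometryGroup (form 3)} (hφ : φ ∉ weylGroup (form 3)) :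
    ∃ y, φ.1 dualVector = -dualVector + theta • y := by
  obtain ⟨w, hw, y, hy⟩ := (exists_weylGroup_mul φ).resolve_left hφ
  obtain ⟨z, hz⟩ := apply_dualVector_of_mem (inv_mem hw)
  have h1 : φ.1 dualVector = (w⁻¹).1 ((w * φ).1 dualVector) := by
    change _ = (w⁻¹ * (w * φ)).1 dualVector
    rw [inv_mul_cancel_left]
  refine ⟨-z + (w⁻¹).1 y, ?_⟩
  rw [h1, hy, map_add, map_neg, hz, map_smul, smul_add, smul_neg]
  abel

theorem mem_weylGroup_form_three {φ : isometryGroup (form 3)} :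
    φ ∈ weylGroup (form 3) ↔ ∃ y, φ.1 dualVector = dualVector + theta • y := by
  refine ⟨apply_dualVector_of_mem, fun ⟨y, hy⟩ => ?_⟩
  by_contra hφ
  obtain ⟨z, hz⟩ := apply_dualVector_of_notMem hφ
  refine dualVector_ne (y := z - y) ?_
  rw [smul_sub, ← add_sub_assoc, ← hz, hy, add_sub_cancel_right]

/-! ### The isometry `-1` and the isometry group of `𝓔₁` -/

/-- The isometry `-1`. -/
def negIsometry {M : Type*} [AddCommGroup M] [Module EInt M] {h : M → M → EInt}
    (hh : IsEisensteinForm h) : isometryGroup h :=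
  ⟨LinearEquiv.neg EInt, fun x y => by
    change h (-x) (-y) = _
    rw [hh.neg_left, hh.neg_right, neg_neg]⟩

section
variable {M : Type*} [AddCommGroup M] [Module EInt M] {h : M → M → EInt}

theorem negIsometry_apply (hh : IsEisensteinForm h) (x : M) : (negIsometry hh).1 x = -x := rfl

theorem negIsometry_mul_self (hh : IsEisensteinForm h) : negIsometry hh * negIsometry hh = 1 :=
  Subtype.ext (LinearEquiv.ext fun x => neg_neg x)

theorem negIsometry_comm (hh : IsEisensteinForm h) (φ : isometryGroup h) :
    negIsometry hh * φ = φ * negIsometry hh :=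
  Subtype.ext (LinearEquiv.ext fun x => (map_neg φ.1 x).symm)

/-- If `v` is not divisible by `θ` and its inner products are divisible by `3`, then `-1` is not in
the reflection group. -/
theorem negIsometry_notMem (hh : IsEisensteinForm h) {v : M} (hv : ∀ x, 3 ∣ h x v)
    (hv' : ∀ y, v ≠ theta • y) : negIsometry hh ∉ weylGroup h := by
  intro H
  obtain ⟨y, hy⟩ := weylGroup_apply_sub_dvd hh hv H
  rw [negIsometry_apply] at hy
  -- From `-v = v + θy` one gets `v = 3v + θy`, and `3 = -θ²`.
  refine hv' (-theta • v + y) ?_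
  rw [smul_add, ← mul_smul, mul_neg, theta_sq, neg_neg, show (3 : EInt) = 1 + 1 + 1 by norm_num,
    add_smul, add_smul, one_smul, add_assoc, ← hy]
  abel

end

/-- A group with an index two subgroup and a central involution outside it is a direct product. -/
theorem nonempty_mulEquiv_prod_of_central {G : Type*} [Group G] (W : Subgroup G) (c : G)
    (hc : c * c = 1) (hcomm : ∀ g, c * g = g * c) (hcW : c ∉ W)
    (hG : ∀ g, g ∈ W ∨ c * g ∈ W) : Nonempty (G ≃* W × Multiplicative (ZMod 2)) := by
  let f : Multiplicative (ZMod 2) →* G :=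
    { toFun := fun x => c ^ (Multiplicative.toAdd x).val
      map_one' := pow_zero c
      map_mul' := by
        have : ∀ x y : ZMod 2, c ^ (x + y).val = c ^ x.val * c ^ y.val := by
          intro x y
          fin_cases x <;> fin_cases y
          · change c ^ 0 = c ^ 0 * c ^ 0
            simp
          · change c ^ 1 = c ^ 0 * c ^ 1
            simp
          · change c ^ 1 = c ^ 1 * c ^ 0
            simp
          · change c ^ 0 = c ^ 1 * c ^ 1
            rw [pow_zero, pow_one, hc]
        exact fun x y => this x.toAdd y.toAdd }
  have hf1 : f (Multiplicative.ofAdd 1) = c := pow_one c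
  have hx : ∀ x : Multiplicative (ZMod 2), x = 1 ∨ x = Multiplicative.ofAdd 1 := by decide
  let F : W × Multiplicative (ZMod 2) →* G := MonoidHom.noncommCoprod W.subtype f fun w x =>
    Commute.pow_right (hcomm w).symm _
  have hF : ∀ w x, F (w, x) = w.1 * f x := fun _ _ => rfl
  refine ⟨(MulEquiv.ofBijective F ⟨?_, ?_⟩).symm⟩
  · rw [injective_iff_map_eq_one]
    rintro ⟨w, x⟩ h
    rw [hF] at h
    rcases hx x with rfl | rfl
    · rw [map_one, mul_one] at h
      exact Prod.ext (Subtype.ext h) rfl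
    · rw [hf1] at h
      refine absurd ?_ hcW
      rw [eq_inv_of_mul_eq_one_right h]
      exact inv_mem w.2
  · intro g
    rcases hG g with h | h
    · exact ⟨(⟨g, h⟩, 1), by rw [hF, map_one, mul_one]⟩
    · exact ⟨(⟨c * g, h⟩, Multiplicative.ofAdd 1), by
        rw [hF, hf1]; change c * g * c = g; rw [hcomm g, mul_assoc, hc, mul_one]⟩

/-- In rank one an isometry is multiplication by a unit, hence a power of `-ω`. This generator is
`-1` times the triflection `T`. -/
theorem mem_weylGroup_form_one (φ : isometryGroup (form 1)) :
    φ ∈ weylGroup (form 1) ∨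
      negIsometry isEisensteinForm_form_one * φ ∈ weylGroup (form 1) := by
  have hh := isEisensteinForm_form_one
  set c := negIsometry hh
  have hc := negIsometry_mul_self hh
  have hcomm := negIsometry_comm hh
  set T := hh.triflection (root 0) (form_root_self 0)
  have hT : T ∈ weylGroup (form 1) := hh.triflection_mem _
  have hpow : ∀ k : ℕ, (c * T) ^ k ∈ weylGroup (form 1) ∨
      c * (c * T) ^ k ∈ weylGroup (form 1) := by
    intro k
    induction k with
    | zero => left; rw [pow_zero]; exact one_mem _
    | succ k ih =>
      rw [pow_succ']
      rcases ih with ih | ih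
      · right
        rw [mul_assoc c T, ← mul_assoc c c, hc, one_mul]
        exact mul_mem hT ih
      · left
        have : c * T * (c * T) ^ k = T * (c * (c * T) ^ k) := by
          rw [← mul_assoc T, hcomm T]
        rw [this]
        exact mul_mem hT ih
  have happ : ∀ k : ℕ, ((c * T) ^ k).1 (root 0) = (-omega) ^ k • root 0 := by
    intro k
    induction k with
    | zero => simp
    | succ k ih =>
      rw [pow_succ', pow_succ]
      change c.1 (T.1 (((c * T) ^ k).1 (root 0))) = _
      rw [ih, map_smul, map_smul, hh.triflection_self, negIsometry_apply, mul_smul, neg_smul]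
  have hφ : φ.1 (root 0) = φ.1 (root 0) 0 • root 0 := by
    ext i : 1
    fin_cases i
    simp [root]
  have hu : nm (φ.1 (root 0) 0) = 1 := by
    have := hh.smul_self (φ.1 (root 0) 0) (root 0)
    rw [← hφ, φ.2, form_root_self] at this
    simp at this
    omega
  obtain ⟨k, hk⟩ := eq_pow_of_nm_eq_one hu
  have : φ = (c * T) ^ k := by
    rw [← inv_mul_eq_one]
    refine isometryGroup_ext fun i => ?_
    fin_cases i
    change (φ.1).symm (((c * T) ^ k).1 (root 0)) = root 0
    rw [LinearEquiv.symm_apply_eq, happ, hφ, hk]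
  rw [this]
  exact hpow k

theorem nonempty_isometryGroup_form_one : Nonempty (isometryGroup (form 1) ≃*
    weylGroup (form 1) × Multiplicative (ZMod 2)) := by
  have hh := isEisensteinForm_form_one
  refine nonempty_mulEquiv_prod_of_central _ (negIsometry hh) (negIsometry_mul_self hh)
    (negIsometry_comm hh) (negIsometry_notMem hh (v := root 0) (fun x => ?_) fun y hy => ?_)
    mem_weylGroup_form_one
  · exact ⟨star (x 0), by simp [form, gramForm, root, dotProduct, Matrix.mulVec, gram, mul_comm]⟩
  · have := congrArg nm (congrFun hy 0)
    simp only [Pi.smul_apply, smul_eq_mul, nm_mul, nm_theta] at this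
    simp [root, nm] at this
    omega

/-! ### Isometries of an orthogonal sum of copies -/

section Wreath

variable {M : Type*} [AddCommGroup M] [Module EInt M] {h : M → M → EInt} {k : ℕ}

/-- An element of the wreath product of the isometry group acts on the orthogonal sum of copies. -/
def wreathEquiv (p : Wreath (isometryGroup h) k) : (Fin k → M) ≃ₗ[EInt] (Fin k → M) where
  toFun x i := (p.left i).1 (x (p.right⁻¹ i))
  invFun x i := (p.left (p.right i)).1.symm (x (p.right i))
  map_add' x y := by ext i : 1; simp
  map_smul' c x := by ext i : 1; simp
  left_inv x := by ext i : 1; simp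
  right_inv x := by ext i : 1; simp

theorem wreathEquiv_apply (p : Wreath (isometryGroup h) k) (x : Fin k → M) (i : Fin k) :
    wreathEquiv p x i = (p.left i).1 (x (p.right⁻¹ i)) := rfl

/-- The action of the wreath product of the isometry group on the orthogonal sum of copies. -/
def wreathHom (h : M → M → EInt) (k : ℕ) :
    Wreath (isometryGroup h) k →* isometryGroup (orthCopies (Fin k) h) where
  toFun p := ⟨wreathEquiv p, fun x y => by
    simp only [orthCopies, wreathEquiv_apply, (p.left _).2 _ _]
    exact Equiv.sum_comp p.right⁻¹ fun i => h (x i) (y i)⟩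
  map_one' := Subtype.ext (LinearEquiv.ext fun x => rfl)
  map_mul' p q := Subtype.ext (LinearEquiv.ext fun x => funext fun i => by
    change wreathEquiv (p * q) x i = wreathEquiv p (wreathEquiv q x) i
    simp only [wreathEquiv_apply, SemidirectProduct.mul_left, SemidirectProduct.mul_right,
      mul_inv_rev]
    rfl)

theorem wreathHom_apply (p : Wreath (isometryGroup h) k) (x : Fin k → M) (i : Fin k) :
    (wreathHom h k p).1 x i = (p.left i).1 (x (p.right⁻¹ i)) := rfl

theorem IsEisensteinForm.orthCopies (hh : IsEisensteinForm h) :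
    IsEisensteinForm (orthCopies (Fin k) h) where
  add_right x y z := by simp [Eisenstein.orthCopies, hh.add_right, Finset.sum_add_distrib]
  smul_right c x y := by simp [Eisenstein.orthCopies, hh.smul_right, Finset.mul_sum]
  star_eq x y := by simp [Eisenstein.orthCopies, hh.star_eq]
  theta_dvd x y := Finset.dvd_sum fun i _ => hh.theta_dvd _ _
  pos x hx := by
    obtain ⟨i, hi⟩ := Function.ne_iff.1 hx
    have : (Eisenstein.orthCopies (Fin k) h x x).re = ∑ i, (h (x i) (x i)).re :=
      map_sum (QuadraticAlgebra.reₗ (-1 : ℤ) (-1)) _ _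
    rw [this]
    exact Finset.sum_pos' (fun i _ => hh.nonneg _) ⟨i, Finset.mem_univ i, hh.pos _ hi⟩

/-- A root of an orthogonal sum of copies lies in one of the summands. -/
theorem exists_component_of_root (hh : IsEisensteinForm h) {x : Fin k → M}
    (hx : orthCopies (Fin k) h x x = 3) : ∃ i, ∀ j, j ≠ i → x j = 0 := by
  have hx0 := hh.orthCopies.ne_zero_of_root hx
  obtain ⟨i, hi⟩ := Function.ne_iff.1 hx0
  refine ⟨i, fun j hj => ?_⟩
  by_contra hxj
  have h1 : (orthCopies (Fin k) h x x).re = ∑ i, (h (x i) (x i)).re :=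
    map_sum (QuadraticAlgebra.reₗ (-1 : ℤ) (-1)) _ _
  have h2 : ∑ l ∈ {i, j}, (h (x l) (x l)).re ≤ ∑ l, (h (x l) (x l)).re :=
    Finset.sum_le_sum_of_subset_of_nonneg (Finset.subset_univ _) fun l _ _ => hh.nonneg _
  rw [← h1, hx, Finset.sum_pair hj.symm] at h2
  have h3 := hh.three_le hi
  have h4 := hh.three_le hxj
  simp at h2
  omega

/-- A family of pairwise orthogonal submodules containing all roots: a form preserving map from
`𝓔ₙ` takes values in one of them. -/
theorem exists_component {n : ℕ} {κ N : Type*} [AddCommGroup N] [Module EInt N]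
    {H : N → N → EInt} (P : κ → Submodule EInt N)
    (hroot : ∀ r, H r r = 3 → ∃ i, r ∈ P i)
    (horth : ∀ i j, i ≠ j → ∀ x ∈ P i, ∀ y ∈ P j, H x y = 0)
    (f : (Fin (n + 1) → EInt) →ₗ[EInt] N) (hf : ∀ x y, H (f x) (f y) = form (n + 1) x y) :
    ∃ i, ∀ x, f x ∈ P i := by
  obtain ⟨i, hi⟩ := hroot (f (root 0)) ((hf _ _).trans (form_root_self _))
  -- Consecutive roots have product `θ ≠ 0`, so their images cannot lie in different, orthogonal
  -- members of the family.
  have key : ∀ (l : ℕ) (hl : l < n + 1), f (root ⟨l, hl⟩) ∈ P i := by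
    intro l
    induction l with
    | zero => exact fun _ => hi
    | succ l ih =>
      intro hl
      obtain ⟨j, hj⟩ := hroot (f (root ⟨l + 1, hl⟩)) ((hf _ _).trans (form_root_self _))
      by_cases hij : i = j
      · rwa [hij]
      · have := horth i j hij _ (ih (by omega)) _ hj
        rw [hf, form_root_succ (by rfl)] at this
        exact absurd this theta_ne_zero
  refine ⟨i, fun x => ?_⟩
  rw [eq_sum_root x, map_sum]
  exact Submodule.sum_mem _ fun l _ => by
    rw [map_smul]
    exact Submodule.smul_mem _ _ (key l l.2)

/-- The summands of an orthogonal sum of copies. -/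
def component (M : Type*) [AddCommGroup M] [Module EInt M] {k : ℕ} (i : Fin k) :
    Submodule EInt (Fin k → M) where
  carrier := {x | ∀ j, j ≠ i → x j = 0}
  add_mem' hx hy j hj := by simp [hx j hj, hy j hj]
  zero_mem' _ _ := rfl
  smul_mem' c x hx j hj := by simp [hx j hj]

theorem component_orthogonal (hh : IsEisensteinForm h) {i j : Fin k} (hij : i ≠ j)
    {x y : Fin k → M} (hx : x ∈ component M i) (hy : y ∈ component M j) :
    orthCopies (Fin k) h x y = 0 := by
  refine Finset.sum_eq_zero fun l _ => ?_
  by_cases hl : l = i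
  · rw [hy l (by rw [hl]; exact hij), hh.zero_right]
  · rw [hx l hl, hh.zero_left]

theorem orthCopies_single (hh : IsEisensteinForm h) (i : Fin k) (x y : M) :
    orthCopies (Fin k) h (Pi.single i x) (Pi.single i y) = h x y := by
  unfold orthCopies
  rw [Finset.sum_eq_single i]
  · simp
  · intro j _ hj
    rw [Pi.single_eq_of_ne hj, hh.zero_left]
  · simp

theorem wreathHom_injective [Nontrivial M] : Function.Injective (wreathHom h k) := by
  rw [injective_iff_map_eq_one]
  intro p hp
  have key : ∀ (x : Fin k → M) (i : Fin k), (p.left i).1 (x (p.right⁻¹ i)) = x i := fun x i => by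
    rw [← wreathHom_apply, hp]; rfl
  have hright : p.right = 1 := by
    ext1 j
    obtain ⟨y, hy⟩ := exists_ne (0 : M)
    by_contra hne
    have := key (Pi.single j y) (p.right j)
    have hj : p.right⁻¹ (p.right j) = j := p.right.symm_apply_apply j
    rw [hj, Pi.single_eq_same, Pi.single_eq_of_ne (show p.right j ≠ j from hne)] at this
    exact hy ((LinearEquiv.map_eq_zero_iff _).1 this)
  refine SemidirectProduct.ext (funext fun i => Subtype.ext (LinearEquiv.ext fun y => ?_)) hright
  have := key (fun _ => y) i
  exact this

/-- Summand `i` is carried into summand `c φ i` by connectedness of the chain. The index map of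
`φ⁻¹` inverts that of `φ`, so the summands are permuted, and the nonzero blocks of `φ` are
isometries of `𝓔ₙ₊₁`. -/
theorem wreathHom_surjective {n : ℕ} (hh : IsEisensteinForm (form (n + 1))) :
    Function.Surjective (wreathHom (form (n + 1)) k) := by
  intro φ
  have hcomp : ∀ (ψ : isometryGroup (orthCopies (Fin k) (form (n + 1)))) (i : Fin k),
      ∃ j, ∀ x, ψ.1 (Pi.single i x) ∈ component (Fin (n + 1) → EInt) j := by
    intro ψ i
    refine exists_component (H := orthCopies (Fin k) (form (n + 1)))
      (fun j => component (Fin (n + 1) → EInt) j)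
      (fun r hr => exists_component_of_root hh hr)
      (fun i j hij x hx y hy => component_orthogonal hh hij hx hy)
      (ψ.1.toLinearMap ∘ₗ LinearMap.single EInt (fun _ => Fin (n + 1) → EInt) i) ?_
    exact fun x y => (ψ.2 _ _).trans (orthCopies_single hh i x y)
  choose c hc using hcomp
  have hc1 : ∀ ψ i x, ψ.1 (Pi.single i x) = Pi.single (c ψ i) (ψ.1 (Pi.single i x) (c ψ i)) := by
    intro ψ i x
    ext1 j
    by_cases hj : j = c ψ i
    · subst hj; simp
    · rw [hc ψ i x j hj, Pi.single_eq_of_ne hj]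
  have hinv : ∀ (ψ χ : isometryGroup (orthCopies (Fin k) (form (n + 1)))) (i : Fin k),
      (∀ x, χ.1 (ψ.1 x) = x) → c χ (c ψ i) = i := by
    intro ψ χ i hψ
    by_contra hne
    have h1 := hψ (Pi.single i (root 0))
    rw [hc1 ψ] at h1
    have h2 := hc χ (c ψ i) (ψ.1 (Pi.single i (root 0)) (c ψ i)) i (Ne.symm hne)
    rw [h1, Pi.single_eq_same] at h2
    exact hh.ne_zero_of_root (form_root_self 0) h2
  have hl : ∀ x, (φ⁻¹).1 (φ.1 x) = x := fun x => φ.1.symm_apply_apply x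
  have hr : ∀ x, φ.1 ((φ⁻¹).1 x) = x := fun x => φ.1.apply_symm_apply x
  let π : Equiv.Perm (Fin k) := ⟨c φ, c φ⁻¹, fun i => hinv _ _ i hl, fun i => hinv _ _ i hr⟩
  have hcc : ∀ i, c φ (c φ⁻¹ i) = i := fun i => hinv _ _ i hr
  -- The block is indexed by its target `i`, to match the convention of `wreathHom`.
  let g (i : Fin k) : isometryGroup (form (n + 1)) :=
    ⟨{ toFun := fun x => φ.1 (Pi.single (c φ⁻¹ i) x) i
       invFun := fun x => (φ⁻¹).1 (Pi.single i x) (c φ⁻¹ i)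
       map_add' := fun x y => by simp [Pi.single_add]
       map_smul' := fun a x => by
        rw [Pi.single_smul, map_smul]; rfl
       left_inv := fun x => by
        have := hc1 φ (c φ⁻¹ i) x
        rw [hcc] at this
        beta_reduce
        rw [← this, hl, Pi.single_eq_same]
       right_inv := fun x => by
        beta_reduce
        rw [← hc1, hr, Pi.single_eq_same] },
      fun x y => by
        have h1 := φ.2 (Pi.single (c φ⁻¹ i) x) (Pi.single (c φ⁻¹ i) y)
        rw [hc1, hc1 φ _ y, orthCopies_single hh, orthCopies_single hh, hcc] at h1
        exact h1⟩
  refine ⟨⟨g, π⟩, ?_⟩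
  apply Subtype.ext
  ext1 x
  ext1 i
  rw [wreathHom_apply]
  change φ.1 (Pi.single (c φ⁻¹ i) (x (π⁻¹ i))) i = _
  have hx : x = ∑ j, Pi.single j (x j) := (Finset.univ_sum_single x).symm
  conv_rhs => rw [hx, map_sum, Finset.sum_apply]
  rw [Finset.sum_eq_single (π⁻¹ i)]
  · rfl
  · intro j _ hj
    refine hc φ j _ i fun hi => hj ?_
    rw [hi]
    exact (π.symm_apply_apply j).symm
  · simp

end Wreath

/-! ### Orthogonal sums of two lattices and the group of `𝓔₁ + 2𝓔₄` -/

section OrthSum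

variable {A B : Type*} [AddCommGroup A] [Module EInt A] [AddCommGroup B] [Module EInt B]
  {a : A → A → EInt} {b : B → B → EInt}

theorem IsEisensteinForm.exists_component_orthSum (ha : IsEisensteinForm a)
    (hb : IsEisensteinForm b) {r : A × B} (hr : orthSum a b r r = 3) : r.1 = 0 ∨ r.2 = 0 := by
  by_contra! H
  have h1 := ha.three_le H.1
  have h2 := hb.three_le H.2
  have h3 : (orthSum a b r r).re = 3 := by rw [hr]; rfl
  simp only [orthSum, QuadraticAlgebra.re_add] at h3
  omega

/-- The product of the isometry groups acts on the orthogonal sum. -/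
def prodHom (a : A → A → EInt) (b : B → B → EInt) :
    isometryGroup a × isometryGroup b →* isometryGroup (orthSum a b) where
  toFun p := ⟨p.1.1.prodCongr p.2.1, fun _ _ => congrArg₂ (· + ·) (p.1.2 _ _) (p.2.2 _ _)⟩
  map_one' := Subtype.ext (LinearEquiv.ext fun _ => rfl)
  map_mul' _ _ := Subtype.ext (LinearEquiv.ext fun _ => rfl)

theorem prodHom_apply (p : isometryGroup a × isometryGroup b) (x : A × B) :
    (prodHom a b p).1 x = (p.1.1 x.1, p.2.1 x.2) := rfl

theorem prodHom_injective : Function.Injective (prodHom a b) := by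
  rw [injective_iff_map_eq_one]
  intro p hp
  have key : ∀ x : A × B, (p.1.1 x.1, p.2.1 x.2) = x := fun x => by
    rw [← prodHom_apply, hp]; rfl
  exact Prod.ext (Subtype.ext (LinearEquiv.ext fun x => congrArg Prod.fst (key (x, 0))))
    (Subtype.ext (LinearEquiv.ext fun x => congrArg Prod.snd (key (0, x))))

theorem prodHom_surjective (ha : IsEisensteinForm a) (hb : IsEisensteinForm b)
    (H : ∀ (φ : isometryGroup (orthSum a b)) (y : B), (φ.1 (0, y)).1 = 0) :
    Function.Surjective (prodHom a b) := by
  intro φ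
  have hl : ∀ (φ : isometryGroup (orthSum a b)) x, (φ⁻¹).1 (φ.1 x) = x :=
    fun φ x => φ.1.symm_apply_apply x
  have hr : ∀ (φ : isometryGroup (orthSum a b)) x, φ.1 ((φ⁻¹).1 x) = x :=
    fun φ x => φ.1.apply_symm_apply x
  -- As `φ⁻¹` also preserves `B`, the image of `A` is orthogonal to `B`; pairing with its own
  -- `B`-component `q` gives `q = 0`.
  have H2 : ∀ (φ : isometryGroup (orthSum a b)) (x : A), (φ.1 (x, 0)).2 = 0 := by
    intro φ x
    set q := (φ.1 (x, 0)).2 with hq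
    have h1 := φ.2 (x, 0) ((φ⁻¹).1 (0, q))
    rw [hr] at h1
    simp only [orthSum, ha.zero_right, H, hb.zero_left, ← hq, zero_add] at h1
    exact hb.eq_zero_of_re (by rw [h1]; rfl)
  have e1 : ∀ (φ : isometryGroup (orthSum a b)) x, φ.1 (x, 0) = ((φ.1 (x, 0)).1, 0) :=
    fun φ x => Prod.ext rfl (H2 φ x)
  have e2 : ∀ (φ : isometryGroup (orthSum a b)) y, φ.1 (0, y) = (0, (φ.1 (0, y)).2) :=
    fun φ y => Prod.ext (H φ y) rfl
  let α : isometryGroup a := ⟨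
    { toFun := fun x => (φ.1 (x, 0)).1
      invFun := fun x => ((φ⁻¹).1 (x, 0)).1
      map_add' := fun x y => by rw [← Prod.fst_add, ← map_add, Prod.mk_add_mk, add_zero]
      map_smul' := fun c x => by
        rw [RingHom.id_apply, ← Prod.smul_fst, ← map_smul, Prod.smul_mk, smul_zero]
      left_inv := fun x => by beta_reduce; rw [← e1, hl]
      right_inv := fun x => by beta_reduce; rw [← e1, hr] },
    fun x y => by
      have := φ.2 (x, 0) (y, 0)
      rw [e1, e1 φ y] at this
      simpa [orthSum, hb.zero_left] using this⟩
  let β : isometryGroup b := ⟨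
    { toFun := fun x => (φ.1 (0, x)).2
      invFun := fun x => ((φ⁻¹).1 (0, x)).2
      map_add' := fun x y => by rw [← Prod.snd_add, ← map_add, Prod.mk_add_mk, add_zero]
      map_smul' := fun c x => by
        rw [RingHom.id_apply, ← Prod.smul_snd, ← map_smul, Prod.smul_mk, smul_zero]
      left_inv := fun x => by beta_reduce; rw [← e2, hl]
      right_inv := fun x => by beta_reduce; rw [← e2, hr] },
    fun x y => by
      have := φ.2 (0, x) (0, y)
      rw [e2, e2 φ y] at this
      simpa [orthSum, ha.zero_left] using this⟩
  refine ⟨(α, β), Subtype.ext (LinearEquiv.ext fun x => ?_)⟩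
  rw [prodHom_apply]
  change ((φ.1 (x.1, 0)).1, (φ.1 (0, x.2)).2) = _
  have hx : x = (x.1, 0) + (0, x.2) := by simp
  conv_rhs => rw [hx, map_add, e1, e2]
  simp

end OrthSum

/-- Inner products in `𝓔₁` are multiples of 3, of which `θ` is not one. This keeps two linked roots
of `𝓔₄` out of `𝓔₁`. -/
theorem form_one_ne_theta (x y : Fin 1 → EInt) : form 1 x y ≠ theta := by
  intro H
  have h1 : form 1 x y = 3 * (star (x 0) * y 0) := by
    simp [form, gramForm, dotProduct, Matrix.mulVec, gram]
    ring
  have h2 := congrArg nm H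
  rw [h1, nm_mul, nm_theta] at h2
  simp only [nm, QuadraticAlgebra.re_ofNat, QuadraticAlgebra.im_ofNat] at h2
  omega

theorem isometry_formE1E4E4_fst (φ : isometryGroup formE1E4E4) (y : Fin 2 → Fin 4 → EInt) :
    (φ.1 (0, y)).1 = 0 := by
  have h1 := isEisensteinForm_form_one
  have h4 := isEisensteinForm_form_four
  have h44 : IsEisensteinForm (orthCopies (Fin 2) (form 4)) := h4.orthCopies
  have key : ∀ (i : Fin 2) x, (φ.1 (0, Pi.single i x)).1 = 0 := by
    intro i
    let f : (Fin 4 → EInt) →ₗ[EInt] (Fin 1 → EInt) × (Fin 2 → Fin 4 → EInt) :=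
      φ.1.toLinearMap ∘ₗ LinearMap.inr EInt _ _ ∘ₗ
        LinearMap.single EInt (fun _ => Fin 4 → EInt) i
    have hf : ∀ x y, formE1E4E4 (f x) (f y) = form 4 x y := fun x y => by
      refine (φ.2 _ _).trans ?_
      change form 1 0 0 + orthCopies (Fin 2) (form 4) (Pi.single i x) (Pi.single i y) = _
      rw [h1.zero_left, zero_add, orthCopies_single h4]
    obtain ⟨c, hc⟩ := exists_component (H := formE1E4E4)
      (fun c : Bool => if c then LinearMap.ker (LinearMap.fst EInt _ _)
        else LinearMap.ker (LinearMap.snd EInt _ _))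
      (fun r hr => by
        rcases h1.exists_component_orthSum h44 hr with h | h
        · exact ⟨true, h⟩
        · exact ⟨false, h⟩)
      (fun c d hcd x hx y hy => by
        change form 1 _ _ + orthCopies (Fin 2) (form 4) _ _ = 0
        cases c <;> cases d
        · exact absurd rfl hcd
        · have hx' : x.2 = 0 := hx
          have hy' : y.1 = 0 := hy
          rw [hx', hy', h1.zero_right, h44.zero_left, add_zero]
        · have hx' : x.1 = 0 := hx
          have hy' : y.2 = 0 := hy
          rw [hx', hy', h1.zero_left, h44.zero_right, add_zero]
        · exact absurd rfl hcd) f hf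
    cases c
    · exfalso
      have e0 : (f (root 0)).2 = 0 := hc (root 0)
      have e := hf (root 0) (root 1)
      rw [form_root_succ rfl] at e
      refine form_one_ne_theta (f (root 0)).1 (f (root 1)).1 ?_
      rw [← e]
      change _ = form 1 _ _ + orthCopies (Fin 2) (form 4) _ _
      rw [e0, h44.zero_left, add_zero]
    · exact hc
  have hy : ((0, y) : (Fin 1 → EInt) × (Fin 2 → Fin 4 → EInt)) =
      (0, Pi.single 0 (y 0)) + (0, Pi.single 1 (y 1)) := by
    rw [Prod.mk_add_mk, add_zero]
    congr 1
    ext i : 1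
    fin_cases i <;> simp
  rw [hy, map_add, Prod.fst_add, key, key, add_zero]

theorem nonempty_isometryGroup_formE1E4E4 : Nonempty (isometryGroup formE1E4E4 ≃*
    (weylGroup (form 1) × Multiplicative (ZMod 2)) × Wreath (weylGroup (form 4)) 2) := by
  have h4 := isEisensteinForm_form_four
  obtain ⟨e1⟩ := nonempty_isometryGroup_form_one
  let e2 : isometryGroup (form 1) × isometryGroup (orthCopies (Fin 2) (form 4)) ≃*
      isometryGroup formE1E4E4 :=
    MulEquiv.ofBijective (prodHom (form 1) (orthCopies (Fin 2) (form 4)))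
      ⟨prodHom_injective, prodHom_surjective isEisensteinForm_form_one h4.orthCopies
        isometry_formE1E4E4_fst⟩
  let e3 : Wreath (isometryGroup (form 4)) 2 ≃* isometryGroup (orthCopies (Fin 2) (form 4)) :=
    MulEquiv.ofBijective (wreathHom (form 4) 2) ⟨wreathHom_injective, wreathHom_surjective h4⟩
  let e4 : isometryGroup (form 4) ≃* weylGroup (form 4) :=
    Subgroup.topEquiv.symm.trans (MulEquiv.subgroupCongr weylGroup_form_four.symm)
  let e5 : Wreath (isometryGroup (form 4)) 2 ≃* Wreath (weylGroup (form 4)) 2 :=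
    SemidirectProduct.congr (MulEquiv.piCongrRight fun _ => e4) (MulEquiv.refl _) fun _ => rfl
  exact ⟨e2.symm.trans (e1.prodCongr (e3.symm.trans e5))⟩

/-! ### The overlattice of `3𝓔₃`, rescaled by `θ` -/

section Transport

variable {M N R S : Type*} [AddCommGroup M] [Module EInt M] [AddCommGroup N] [Module EInt N]

/-- A linear equivalence compatible with two forms identifies their isometry groups. -/
def isometryGroupCongr {h : M → M → R} {k : N → N → S} (e : M ≃ₗ[EInt] N)
    (H : ∀ x y x' y', h x y = h x' y' ↔ k (e x) (e y) = k (e x') (e y')) :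
    isometryGroup h ≃* isometryGroup k where
  toFun φ := ⟨e.symm.trans (φ.1.trans e), fun x y => by
    have := (H (φ.1 (e.symm x)) (φ.1 (e.symm y)) (e.symm x) (e.symm y)).1 (φ.2 _ _)
    simpa using this⟩
  invFun φ := ⟨e.trans (φ.1.trans e.symm), fun x y => by
    rw [H]
    simpa using φ.2 (e x) (e y)⟩
  left_inv φ := Subtype.ext (LinearEquiv.ext fun x => by simp)
  right_inv φ := Subtype.ext (LinearEquiv.ext fun x => by simp)
  map_mul' φ ψ := Subtype.ext (LinearEquiv.ext fun x => by simp)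

/-- A group acting by isometries that preserve a submodule acts on the submodule. -/
def restrictHom {Γ : Type*} [Group Γ] {h : M → M → R} (F : Γ →* isometryGroup h)
    (L : Submodule EInt M) (hF : ∀ p, ∀ x ∈ L, (F p).1 x ∈ L) :
    Γ →* isometryGroup fun x y : L => h x y where
  toFun p := ⟨
    { toFun := fun x => ⟨(F p).1 x, hF p x x.2⟩
      invFun := fun x => ⟨(F p⁻¹).1 x, hF p⁻¹ x x.2⟩
      map_add' := fun x y => Subtype.ext (map_add (F p).1 x.1 y.1)
      map_smul' := fun c x => Subtype.ext (map_smul (F p).1 c x.1)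
      left_inv := fun x => Subtype.ext (by
        change (F p⁻¹).1 ((F p).1 x.1) = x.1
        rw [map_inv]
        exact (F p).1.symm_apply_apply x.1)
      right_inv := fun x => Subtype.ext (by
        change (F p).1 ((F p⁻¹).1 x.1) = x.1
        rw [map_inv]
        exact (F p).1.apply_symm_apply x.1) },
    fun x y => (F p).2 x y⟩
  map_one' := Subtype.ext (LinearEquiv.ext fun x => Subtype.ext (by
    change (F 1).1 x.1 = x.1
    rw [map_one]; rfl))
  map_mul' p q := Subtype.ext (LinearEquiv.ext fun x => Subtype.ext (by
    change (F (p * q)).1 x.1 = (F p).1 ((F q).1 x.1)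
    rw [map_mul]; rfl))

end Transport

/-- The glue vector of the overlattice, multiplied by `θ`. -/
def scaledGlue : Fin 3 → Fin 3 → EInt := fun _ => dualVector

/-- The overlattice of `3𝓔₃`, multiplied by `θ`. -/
def scaledOverlattice : Submodule EInt (Fin 3 → Fin 3 → EInt) where
  carrier := {x | ∃ (c : EInt) (y : Fin 3 → Fin 3 → EInt), x = c • scaledGlue + theta • y}
  add_mem' := by
    rintro _ _ ⟨c, y, rfl⟩ ⟨d, z, rfl⟩
    exact ⟨c + d, y + z, by rw [add_smul, smul_add]; abel⟩
  zero_mem' := ⟨0, 0, by simp⟩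
  smul_mem' := by
    rintro a _ ⟨c, y, rfl⟩
    exact ⟨a * c, a • y, by rw [smul_add, mul_smul, smul_comm a theta]⟩

theorem theta_smul_mem (x : Fin 3 → Fin 3 → EInt) : theta • x ∈ scaledOverlattice :=
  ⟨0, x, by simp⟩

/-- The inverse of `θ` in `ℚ(ω)`. -/
def thetaInv : EField := ⟨-1 / 3, -2 / 3⟩

theorem toField_theta_mul_thetaInv : toField theta * thetaInv = 1 := by
  rw [theta_eq]
  ext <;> simp [toField, thetaInv] <;> norm_num

theorem toField_injective : Function.Injective toField := fun x y h => by
  have h1 := congrArg QuadraticAlgebra.re h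
  have h2 := congrArg QuadraticAlgebra.im h
  simp [toField] at h1 h2
  ext <;> assumption

theorem toField_star (x : EInt) : toField (star x) = star (toField x) := by
  ext <;> simp [toField]

theorem algebra_smul_def (c : EInt) (x : EField) : c • x = toField c * x := rfl

/-- Division by `θ`, from `3𝓔₃` to `3𝓔₃ ⊗ ℚ(ω)`. -/
def divideByTheta : (Fin 3 → Fin 3 → EInt) →ₗ[EInt] (Fin 3 → Fin 3 → EField) where
  toFun x i j := toField (x i j) * thetaInv
  map_add' x y := by ext i j : 2; simp [add_mul]
  map_smul' c x := by
    ext i j : 2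
    simp only [Pi.smul_apply, smul_eq_mul, map_mul, RingHom.id_apply, algebra_smul_def, mul_assoc]

theorem divideByTheta_apply (x : Fin 3 → Fin 3 → EInt) (i j : Fin 3) :
    divideByTheta x i j = toField (x i j) * thetaInv := rfl

theorem divideByTheta_injective : Function.Injective divideByTheta := fun x y h => by
  ext i j : 2
  have := congrFun (congrFun h i) j
  rw [divideByTheta_apply, divideByTheta_apply] at this
  have h2 := congrArg (· * toField theta) this
  simp only [mul_assoc, mul_comm thetaInv, toField_theta_mul_thetaInv, mul_one] at h2
  exact toField_injective h2

theorem divideByTheta_theta_smul (x : Fin 3 → Fin 3 → EInt) (i j : Fin 3) :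
    divideByTheta (theta • x) i j = toField (x i j) := by
  rw [divideByTheta_apply, Pi.smul_apply, Pi.smul_apply, smul_eq_mul, map_mul, mul_right_comm,
    toField_theta_mul_thetaInv, one_mul]

theorem divideByTheta_scaledGlue :
    divideByTheta scaledGlue = fun _ j => (1 / 3 : ℚ) • toField (glueVector j) := by
  ext1 i
  ext1 j
  rw [divideByTheta_apply]
  fin_cases j <;> ext <;>
    simp [scaledGlue, dualVector, glueVector, toField, thetaInv, theta_eq] <;> norm_num

theorem overlattice_eq_map : overlattice = scaledOverlattice.map divideByTheta := by
  apply le_antisymm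
  · refine Submodule.span_le.2 ?_
    rintro _ (⟨x, rfl⟩ | rfl)
    · refine ⟨theta • x, theta_smul_mem x, ?_⟩
      ext i j : 2
      exact divideByTheta_theta_smul x i j
    · exact ⟨scaledGlue, ⟨1, 0, by simp⟩, divideByTheta_scaledGlue⟩
  · rintro _ ⟨_, ⟨c, y, rfl⟩, rfl⟩
    rw [map_add, map_smul, divideByTheta_scaledGlue]
    refine Submodule.add_mem _ (Submodule.smul_mem _ _ ?_) ?_
    · exact Submodule.subset_span (Or.inr rfl)
    · refine Submodule.subset_span (Or.inl ⟨y, ?_⟩)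
      ext i j : 2
      exact (divideByTheta_theta_smul y i j).symm

/-- The identification of the scaled overlattice with the overlattice. -/
noncomputable def scaledOverlatticeEquiv : scaledOverlattice ≃ₗ[EInt] overlattice :=
  (Submodule.equivMapOfInjective divideByTheta divideByTheta_injective scaledOverlattice).trans
    (LinearEquiv.ofEq _ _ overlattice_eq_map.symm)

theorem scaledOverlatticeEquiv_apply (x : scaledOverlattice) :
    (scaledOverlatticeEquiv x : Fin 3 → Fin 3 → EField) = divideByTheta x := rfl

/-- Dividing by `θ` scales the form by `1/3`, which does not change the isometry group. -/
theorem overlatticeForm_apply (x y : scaledOverlattice) :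
    overlatticeForm (scaledOverlatticeEquiv x) (scaledOverlatticeEquiv y) =
      toField (orthCopies (Fin 3) (form 3) x.1 y.1) * (star thetaInv * thetaInv) := by
  simp only [overlatticeForm, orthCopies, scaledOverlatticeEquiv_apply, form, gramForm,
    dotProduct, Matrix.mulVec, map_sum, map_mul, Finset.sum_mul, Finset.mul_sum, Pi.star_apply,
    toField_star, divideByTheta_apply, star_mul, Matrix.map_apply]
  refine Finset.sum_congr rfl fun i _ => Finset.sum_congr rfl fun j _ =>
    Finset.sum_congr rfl fun k _ => ?_
  ring

theorem star_thetaInv_mul : toField 3 * (star thetaInv * thetaInv) = 1 := by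
  ext <;> simp [toField, thetaInv] <;> norm_num

/-- The isometries of the overlattice are those of the scaled overlattice. -/
noncomputable def isometryGroupOverlatticeEquiv :
    isometryGroup (fun x y : scaledOverlattice => orthCopies (Fin 3) (form 3) x.1 y.1) ≃*
      isometryGroup overlatticeForm :=
  isometryGroupCongr scaledOverlatticeEquiv fun x y x' y' => by
    simp only [overlatticeForm_apply]
    refine ⟨fun h => by rw [h], fun h => toField_injective ?_⟩
    have := congrArg (toField 3 * ·) h
    beta_reduce at this
    rwa [mul_left_comm, star_thetaInv_mul, mul_one, mul_left_comm, star_thetaInv_mul,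
      mul_one] at this

/-! ### Extending isometries of the overlattice to `3𝓔₃` -/

/-- The vector `d` has norm 6, and `θy` has norm three times a multiple of 3. The cross term is the
trace of `3θ` times an Eisenstein integer, hence also a multiple of 9. -/
theorem nine_dvd_re_form_sub (c : EInt) (y : Fin 3 → EInt) :
    9 ∣ (form 3 (c • dualVector + theta • y) (c • dualVector + theta • y)).re - 6 * nm c := by
  have hh := isEisensteinForm_form_three
  obtain ⟨b, hb⟩ := three_dvd_form_dualVector y
  obtain ⟨m, hm⟩ := hh.three_dvd y
  have hb' := hh.flip_eq hb
  rw [hh.norm_add, hh.smul_self, hh.smul_self, nm_theta, hm, hh.smul_left, hh.smul_right, hb',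
    show (form 3 dualVector dualVector).re = 6 by decide]
  have : tr (star c * (theta * star (3 * b))) = 9 * -(star c * star b).im := by
    have h1 : star c * (theta * star (3 * b)) = theta * (3 * (star c * star b)) := by
      rw [star_mul, show star (3 : EInt) = 3 by decide]
      ring
    rw [h1, tr_theta_mul]
    simp only [QuadraticAlgebra.im_mul, QuadraticAlgebra.re_ofNat, QuadraticAlgebra.im_ofNat]
    ring
  rw [this]
  exact ⟨-(star c * star b).im + m, by ring⟩

/-- The vectors of norm `9` in the scaled overlattice are divisible by `θ`. -/
theorem exists_eq_theta_smul {x : Fin 3 → Fin 3 → EInt} (hx : x ∈ scaledOverlattice)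
    (hn : (orthCopies (Fin 3) (form 3) x x).re = 9) : ∃ y, x = theta • y := by
  have hh := isEisensteinForm_form_three
  obtain ⟨c, y, rfl⟩ := hx
  by_cases hc : 3 ∣ c.re + c.im
  · obtain ⟨d, rfl⟩ := theta_dvd_of_three_dvd hc
    exact ⟨d • scaledGlue + y, by rw [smul_add, mul_smul]⟩
  -- If `θ` does not divide `c`, then `nm c ≡ 1` modulo 3, so each of the three components has norm
  -- `≡ 6` modulo 9. The total is at least 18.
  · exfalso
    have hmod : nm c % 3 = 1 := by
      have h1 : nm c = (c.re + c.im) ^ 2 - 3 * (c.re * c.im) := by unfold nm; ring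
      have h2 : (c.re + c.im) ^ 2 % 3 = 1 := by
        have : (c.re + c.im) % 3 = 1 ∨ (c.re + c.im) % 3 = 2 := by omega
        rcases this with h | h <;> rw [pow_two, Int.mul_emod, h] <;> rfl
      omega
    have key : ∀ i, 6 ≤ (form 3 ((c • scaledGlue + theta • y) i)
        ((c • scaledGlue + theta • y) i)).re := fun i => by
      have h1 := nine_dvd_re_form_sub c (y i)
      have h2 := hh.nonneg (c • dualVector + theta • y i)
      change 6 ≤ (form 3 (c • dualVector + theta • y i) (c • dualVector + theta • y i)).re
      omega
    have h1 := key 0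
    have h2 := key 1
    have h3 := key 2
    simp only [orthCopies, Fin.sum_univ_three, QuadraticAlgebra.re_add] at hn
    omega

/-- Every isometry of the scaled overlattice extends to `3𝓔₃`. -/
theorem exists_extension
    (φ : isometryGroup fun x y : scaledOverlattice => orthCopies (Fin 3) (form 3) x.1 y.1) :
    ∃ ψ : isometryGroup (orthCopies (Fin 3) (form 3)),
      ∀ x : scaledOverlattice, (φ.1 x : Fin 3 → Fin 3 → EInt) = ψ.1 x := by
  have h3 := isEisensteinForm_form_three
  have hh : IsEisensteinForm (orthCopies (Fin 3) (form 3)) := h3.orthCopies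
  let t : (Fin 3 → Fin 3 → EInt) →ₗ[EInt] scaledOverlattice :=
    LinearMap.codRestrict scaledOverlattice (LinearMap.lsmul EInt _ theta) theta_smul_mem
  have ht : ∀ x, (t x : Fin 3 → Fin 3 → EInt) = theta • x := fun _ => rfl
  -- It suffices to treat `θ` times a basis root: its norm is 9, which characterises divisibility by
  -- `θ`. The extension is then `θ⁻¹φθ`.
  have key : ∀ (φ : isometryGroup fun x y : scaledOverlattice =>
      orthCopies (Fin 3) (form 3) x.1 y.1) (x : Fin 3 → Fin 3 → EInt),
      ∃ y, (φ.1 (t x) : Fin 3 → Fin 3 → EInt) = theta • y := by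
    intro φ
    let Q : Submodule EInt (Fin 3 → Fin 3 → EInt) :=
      (LinearMap.range (LinearMap.lsmul EInt (Fin 3 → Fin 3 → EInt) theta)).comap
        (scaledOverlattice.subtype ∘ₗ φ.1.toLinearMap ∘ₗ t)
    have hroot : ∀ i j, Pi.single i (root j) ∈ Q := by
      intro i j
      obtain ⟨y, hy⟩ := exists_eq_theta_smul (φ.1 (t (Pi.single i (root j)))).2 (by
        have h1 := φ.2 (t (Pi.single i (root j))) (t (Pi.single i (root j)))
        beta_reduce at h1
        rw [h1, ht, hh.smul_self, orthCopies_single h3, form_root_self, nm_theta]; rfl)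
      exact ⟨y, hy.symm⟩
    have hQ : ∀ x, x ∈ Q := by
      intro x
      rw [← Finset.univ_sum_single x]
      refine Submodule.sum_mem _ fun i _ => ?_
      rw [eq_sum_root (x i), ← LinearMap.single_apply (R := EInt), map_sum]
      refine Submodule.sum_mem _ fun j _ => ?_
      rw [map_smul]
      exact Submodule.smul_mem _ _ (hroot i j)
    intro x
    obtain ⟨y, hy⟩ := hQ x
    exact ⟨y, hy.symm⟩
  choose f hf using key
  have hcancel : ∀ {x y : Fin 3 → Fin 3 → EInt}, theta • x = theta • y → x = y :=
    fun H => hh.smul_cancel theta_ne_zero H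
  have hinv : ∀ φ χ x, (∀ x, χ.1 (φ.1 x) = x) → f χ (f φ x) = x := by
    intro φ χ x H
    apply hcancel
    have h1 : t (f φ x) = φ.1 (t x) := Subtype.ext (by rw [ht, hf])
    rw [← hf, h1, H, ht]
  let ψ : isometryGroup (orthCopies (Fin 3) (form 3)) := ⟨
    { toFun := f φ
      invFun := f φ⁻¹
      map_add' := fun x y => hcancel (by
        rw [← hf, map_add, map_add, smul_add, ← hf, ← hf]; rfl)
      map_smul' := fun c x => hcancel (by
        rw [← hf, map_smul, map_smul, RingHom.id_apply, smul_comm theta c, ← hf]; rfl)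
      left_inv := fun x => hinv _ _ x φ.1.symm_apply_apply
      right_inv := fun x => hinv _ _ x φ.1.apply_symm_apply },
    fun x y => by
      have h1 := φ.2 (t x) (t y)
      beta_reduce at h1
      rw [hf, hf, ht, ht, hh.smul_left, hh.smul_left, hh.smul_right, hh.smul_right] at h1
      exact mul_left_cancel₀ theta_ne_zero (mul_left_cancel₀ (star_ne_zero.2 theta_ne_zero) h1)⟩
  refine ⟨ψ, fun x => hcancel ?_⟩
  change _ = theta • f φ x
  rw [← hf, show t x = theta • x from rfl, map_smul]
  rfl

/-! ### The twisted wreath product and the group of the overlattice -/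

section Twist

variable {G : Type*} [Group G] (W : Subgroup G) [W.Normal] (Z : Subgroup G) (k : ℕ)

/-- The homomorphism `(Wᵏ ⋊ S_k) ⋊ Z → Gᵏ ⋊ S_k` that is the diagonal embedding on `Z`. -/
def twistHom : Wreath W k ⋊[(diagConj W k).comp Z.subtype] Z →* Wreath G k where
  toFun p := ⟨fun i => p.left.left i * p.right, p.left.right⟩
  map_one' := SemidirectProduct.ext (funext fun _ => mul_one _) rfl
  map_mul' p q := by
    refine SemidirectProduct.ext (funext fun i => ?_) rfl
    change (p.left.left i : G) * (p.right * q.left.left (p.left.right⁻¹ i) * (p.right : G)⁻¹) *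
      (p.right * q.right) = p.left.left i * p.right *
        (q.left.left (p.left.right⁻¹ i) * q.right)
    group

theorem twistHom_left_mem_iff (p : Wreath W k ⋊[(diagConj W k).comp Z.subtype] Z) (i : Fin k) :
    (twistHom W Z k p).left i ∈ W ↔ (p.right : G) ∈ W :=
  Subgroup.mul_mem_cancel_left _ (p.left.left i).2

theorem twistHom_injective [NeZero k] (hZ : ∀ z ∈ Z, z ∈ W → z = 1) :
    Function.Injective (twistHom W Z k) := by
  rw [injective_iff_map_eq_one]
  intro p hp
  have h1 : ∀ i, (p.left.left i : G) * p.right = 1 := fun i =>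
    congrFun (congrArg SemidirectProduct.left hp) i
  have h2 : p.left.right = 1 := congrArg SemidirectProduct.right hp
  have h3 : p.right = 1 := Subtype.ext (hZ _ p.right.2 (by
    rw [eq_inv_of_mul_eq_one_right (h1 0)]
    exact inv_mem (p.left.left 0).2))
  refine SemidirectProduct.ext (SemidirectProduct.ext (funext fun i => Subtype.ext ?_) h2) h3
  have := h1 i
  rw [h3] at this
  simpa using this

end Twist

theorem mul_inv_mem_weylGroup {φ ψ : isometryGroup (form 3)} (hφ : φ ∉ weylGroup (form 3))
    (hψ : ψ ∉ weylGroup (form 3)) : φ * ψ⁻¹ ∈ weylGroup (form 3) := by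
  obtain ⟨y, hy⟩ := apply_dualVector_of_notMem hφ
  obtain ⟨z, hz⟩ := apply_dualVector_of_notMem (fun h => hψ (inv_mem_iff.1 h))
  refine mem_weylGroup_form_three.2 ⟨-y + φ.1 z, ?_⟩
  change φ.1 ((ψ⁻¹).1 dualVector) = _
  rw [hz, map_add, map_neg, hy, map_smul, smul_add, smul_neg]
  abel

/-- An isometry of `3𝓔₃` that acts by the same sign on the three discriminant groups preserves the
scaled overlattice. -/
theorem wreathHom_mem_scaledOverlattice {p : Wreath (isometryGroup (form 3)) 3}
    (hp : (∀ i, p.left i ∈ weylGroup (form 3)) ∨ ∀ i, p.left i ∉ weylGroup (form 3))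
    {x : Fin 3 → Fin 3 → EInt} (hx : x ∈ scaledOverlattice) :
    (wreathHom (form 3) 3 p).1 x ∈ scaledOverlattice := by
  have hε : ∃ ε : EInt, ∀ i, ∃ y, (p.left i).1 dualVector = ε • dualVector + theta • y := by
    rcases hp with hp | hp
    · exact ⟨1, fun i => by simpa using apply_dualVector_of_mem (hp i)⟩
    · exact ⟨-1, fun i => by simpa using apply_dualVector_of_notMem (hp i)⟩
  obtain ⟨ε, hε⟩ := hε
  choose z hz using hε
  obtain ⟨c, y, rfl⟩ := hx
  refine ⟨c * ε, fun i => c • z i + (p.left i).1 (y (p.right⁻¹ i)), ?_⟩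
  ext1 i
  rw [wreathHom_apply]
  change (p.left i).1 (c • dualVector + theta • y (p.right⁻¹ i)) =
    (c * ε) • dualVector + theta • (c • z i + (p.left i).1 (y (p.right⁻¹ i)))
  rw [map_add, map_smul, map_smul, hz, smul_add, smul_add, mul_smul, smul_comm c theta, add_assoc]

/-- An isometry of `3𝓔₃` that maps the glue vector into the scaled overlattice acts by the same
sign on the three discriminant groups. -/
theorem forall_mem_or_forall_notMem {p : Wreath (isometryGroup (form 3)) 3}
    (hp : (wreathHom (form 3) 3 p).1 scaledGlue ∈ scaledOverlattice) :
    (∀ i, p.left i ∈ weylGroup (form 3)) ∨ ∀ i, p.left i ∉ weylGroup (form 3) := by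
  by_contra! H
  obtain ⟨⟨i, hi⟩, j, hj⟩ := H
  obtain ⟨c, y, hc⟩ := hp
  have key : ∀ l, (p.left l).1 dualVector = c • dualVector + theta • y l := fun l => congrFun hc l
  obtain ⟨u, hu⟩ := apply_dualVector_of_notMem hi
  obtain ⟨v, hv⟩ := apply_dualVector_of_mem hj
  rw [key] at hu hv
  -- The same `c` serves every component, so opposite signs would give `d ≡ -d` modulo `θ`.
  refine dualVector_ne (y := u - y i + y j - v) ?_
  rw [smul_sub, smul_add, smul_sub, ← sub_eq_zero]
  have h1 := sub_eq_zero.2 hu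
  have h2 := sub_eq_zero.2 hv
  linear_combination (exp := 1) h1 - h2

/-- An element of order two outside a subgroup generates a complement to it. -/
theorem eq_one_of_mem_zpowers {G : Type*} [Group G] {W : Subgroup G} {τ : G}
    (hτ : orderOf τ = 2) (hτW : τ ∉ W) : ∀ z ∈ Subgroup.zpowers τ, z ∈ W → z = 1 := by
  rintro _ ⟨n, rfl⟩ hn
  have h2 : τ ^ (2 : ℤ) = 1 := by
    have := pow_orderOf_eq_one τ
    rw [hτ] at this
    exact_mod_cast this
  change τ ^ n ∈ W at hn
  change τ ^ n = 1
  rcases Int.even_or_odd' n with ⟨m, rfl | rfl⟩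
  · rw [zpow_mul, h2, one_zpow]
  · rw [zpow_add, zpow_mul, h2, one_zpow, one_mul, zpow_one] at hn
    exact absurd hn hτW

/-- The group that acts on the overlattice in `nonempty_isometryGroup_overlatticeForm`. -/
abbrev TwistedWreath (τ : isometryGroup (form 3)) : Type :=
  Wreath (weylGroup (form 3)) 3
    ⋊[(diagConj (weylGroup (form 3)) 3).comp (Subgroup.zpowers τ).subtype] Subgroup.zpowers τ

/-- The action of the twisted wreath product on `3𝓔₃`. -/
def twistedWreathHom (τ : isometryGroup (form 3)) :
    TwistedWreath τ →* isometryGroup (orthCopies (Fin 3) (form 3)) :=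
  (wreathHom (form 3) 3).comp (twistHom (weylGroup (form 3)) (Subgroup.zpowers τ) 3)

theorem twistedWreathHom_mem (τ : isometryGroup (form 3)) (p : TwistedWreath τ)
    (x : Fin 3 → Fin 3 → EInt) (hx : x ∈ scaledOverlattice) :
    (twistedWreathHom τ p).1 x ∈ scaledOverlattice := by
  refine wreathHom_mem_scaledOverlattice ?_ hx
  by_cases h : (p.right : isometryGroup (form 3)) ∈ weylGroup (form 3)
  · exact Or.inl fun i => (twistHom_left_mem_iff _ _ 3 p i).2 h
  · exact Or.inr fun i hi => h ((twistHom_left_mem_iff _ _ 3 p i).1 hi)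

/-- The action of the twisted wreath product on the scaled overlattice. -/
def overlatticeHom (τ : isometryGroup (form 3)) : TwistedWreath τ →*
    isometryGroup fun x y : scaledOverlattice => orthCopies (Fin 3) (form 3) x.1 y.1 :=
  restrictHom (twistedWreathHom τ) scaledOverlattice (twistedWreathHom_mem τ)

theorem overlatticeHom_apply (τ : isometryGroup (form 3)) (p : TwistedWreath τ)
    (x : scaledOverlattice) : ((overlatticeHom τ p).1 x : Fin 3 → Fin 3 → EInt) =
      (twistedWreathHom τ p).1 x := rfl

theorem overlatticeHom_injective {τ : isometryGroup (form 3)} (hτ : orderOf τ = 2)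
    (hτW : τ ∉ weylGroup (form 3)) : Function.Injective (overlatticeHom τ) := by
  have hh : IsEisensteinForm (orthCopies (Fin 3) (form 3)) :=
    isEisensteinForm_form_three.orthCopies
  have hinj : Function.Injective (twistedWreathHom τ) :=
    wreathHom_injective.comp (twistHom_injective _ _ 3 (eq_one_of_mem_zpowers hτ hτW))
  rw [injective_iff_map_eq_one]
  intro p hp
  refine (injective_iff_map_eq_one _).1 hinj p ?_
  -- An isometry of `3𝓔₃` is determined on the scaled overlattice, which contains `θx` for every
  -- `x`.
  refine Subtype.ext (LinearEquiv.ext fun x => hh.smul_cancel theta_ne_zero ?_)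
  rw [← map_smul]
  have := overlatticeHom_apply τ p ⟨theta • x, theta_smul_mem x⟩
  rw [hp] at this
  exact this.symm

/-- If all components lie outside `W`, removing one common factor `τ` brings them all into `W`,
which has index two. -/
theorem exists_twistHom_eq {τ : isometryGroup (form 3)} (hτW : τ ∉ weylGroup (form 3))
    {q : Wreath (isometryGroup (form 3)) 3}
    (hq : (∀ i, q.left i ∈ weylGroup (form 3)) ∨ ∀ i, q.left i ∉ weylGroup (form 3)) :
    ∃ p, twistHom (weylGroup (form 3)) (Subgroup.zpowers τ) 3 p = q := by
  rcases hq with h | h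
  · exact ⟨⟨⟨fun i => ⟨q.left i, h i⟩, q.right⟩, 1⟩,
      SemidirectProduct.ext (funext fun i => mul_one _) rfl⟩
  · exact ⟨⟨⟨fun i => ⟨q.left i * τ⁻¹, mul_inv_mem_weylGroup (h i) hτW⟩, q.right⟩,
      ⟨τ, Subgroup.mem_zpowers τ⟩⟩,
      SemidirectProduct.ext (funext fun i => inv_mul_cancel_right _ _) rfl⟩

theorem overlatticeHom_surjective {τ : isometryGroup (form 3)}
    (hτW : τ ∉ weylGroup (form 3)) : Function.Surjective (overlatticeHom τ) := by
  intro φ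
  obtain ⟨ψ, hψ⟩ := exists_extension φ
  obtain ⟨q, rfl⟩ := wreathHom_surjective isEisensteinForm_form_three ψ
  obtain ⟨p, rfl⟩ := exists_twistHom_eq hτW (forall_mem_or_forall_notMem (p := q) (by
    rw [← hψ ⟨scaledGlue, 1, 0, by simp⟩]
    exact (φ.1 _).2))
  exact ⟨p, Subtype.ext (LinearEquiv.ext fun x => Subtype.ext (hψ x).symm)⟩

theorem nonempty_isometryGroup_overlatticeForm (τ : isometryGroup (form 3)) (hτ : orderOf τ = 2)
    (hτW : τ ∉ weylGroup (form 3)) :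
    Nonempty (isometryGroup overlatticeForm ≃* TwistedWreath τ) :=
  ⟨isometryGroupOverlatticeEquiv.symm.trans (MulEquiv.ofBijective (overlatticeHom τ)
    ⟨overlatticeHom_injective hτ hτW, overlatticeHom_surjective hτW⟩).symm⟩

/-- The isometry `-1` acts on `d` with sign `-1`. -/
theorem exists_involution : ∃ τ : isometryGroup (form 3),
    orderOf τ = 2 ∧ τ ∉ weylGroup (form 3) := by
  have hh := isEisensteinForm_form_three
  have hnot : negIsometry hh ∉ weylGroup (form 3) := by
    refine negIsometry_notMem hh three_dvd_form_dualVector fun y hy => ?_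
    refine dualVector_ne (y := (2 : EInt) • y) ?_
    rw [smul_comm, ← hy, two_smul, neg_add_cancel_left]
  refine ⟨negIsometry hh, orderOf_eq_prime ?_ fun h => hnot (h ▸ one_mem _), hnot⟩
  rw [pow_two, negIsometry_mul_self]

end Eisenstein

theorem proposition6p10 :
    -- the isometry group of `𝓔₁ + 2𝓔₄`
    Nonempty (Eisenstein.isometryGroup Eisenstein.formE1E4E4 ≃*
      (Eisenstein.weylGroup (Eisenstein.form 1) × Multiplicative (ZMod 2)) ×
        Eisenstein.Wreath (Eisenstein.weylGroup (Eisenstein.form 4)) 2) ∧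
    -- the isometry group of the index 3 overlattice of `3𝓔₃`
    (∃ τ : Eisenstein.isometryGroup (Eisenstein.form 3),
      orderOf τ = 2 ∧ τ ∉ Eisenstein.weylGroup (Eisenstein.form 3)) ∧
    ∀ τ : Eisenstein.isometryGroup (Eisenstein.form 3),
      orderOf τ = 2 → τ ∉ Eisenstein.weylGroup (Eisenstein.form 3) →
      Nonempty (Eisenstein.isometryGroup Eisenstein.overlatticeForm ≃*
        Eisenstein.Wreath (Eisenstein.weylGroup (Eisenstein.form 3)) 3
          ⋊[(Eisenstein.diagConj (Eisenstein.weylGroup (Eisenstein.form 3)) 3).comp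
              (Subgroup.zpowers τ).subtype] Subgroup.zpowers τ) :=
  ⟨Eisenstein.nonempty_isometryGroup_formE1E4E4, Eisenstein.exists_involution,
    Eisenstein.nonempty_isometryGroup_overlatticeForm⟩
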